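/- Let $0\le p\le q$ be integers, let $a_1,\dots,a_p>0$ and $b_1,\dots,b_q>0$, put $r=q-p$, let $e_k$ denote the $k$-th elementary symmetric polynomial ($e_0=1$), and suppose that $$\frac{e_q(b_1,\dots,b_q)}{e_{p}(a_1,\dots,a_p)}\le\frac{e_{q-1}(b_1,\dots,b_q)}{e_{p-1}(a_1,\dots,a_p)}\le\cdots\le\frac{e_{r+1}(b_1,\dots,b_q)}{e_1(a_1,\dots,a_p)}\le e_r(b_1,\dots,b_q)$$ (no condition if $p=0$). With $(c)_n=c(c+1)\cdots(c+n-1)$, let $$f(\nu,x)=\frac1{\Gamma(\nu)}\,{}_pF_{q+1}(a_1,\dots,a_p;\nu,b_1,\dots,b_q;x)=\sum_{n=0}^\infty\frac{(a_1)_n\cdots(a_p)_n}{(b_1)_n\cdots(b_q)_n}\,\frac{x^n}{n!\,\Gamma(\nu+n)},$$ where $1/\Gamma$ is $0$ at the poles of $\Gamma$; the last series converges for all real $\nu,x$ and defines $f(\nu,x)$ for $\nu=0,-1,-2,\dots$, where the middle expression is not defined (for all other $\nu$ the series of ${}_pF_{q+1}$ converges for all real $x$ and the two expressions agree). Then: 1.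 For each fixed $x\ge0$ the function $\nu\mapsto f(\nu,x)$ is positive and strictly log-concave on $(0,\infty)$. Let further $\mu\ge-1$, $\alpha,\beta>0$, $\mu+\alpha\ge0$, $\mu+\beta\ge0$, and $$\varphi(x)=f(\alpha+\mu,x)f(\beta+\mu,x)-f(\alpha+\beta+\mu,x)f(\mu,x).$$ 2. $\varphi(x)=\sum_{m\ge0}\varphi_mx^m$ for all real $x$, with $\varphi_m>0$ for all $m\ge 0$, except that $\varphi_0=0$ if $\mu=-1$ and $\alpha=1$ or $\beta=1$, and $\varphi_1=0$ if $\mu+\alpha=\mu+\beta=0$. On $(0,\infty)$ the function $\varphi$ is positive, absolutely monotonic and multiplicatively convex, i.e. $\varphi(x^{t}y^{1-t})\le\varphi(x)^{t}\varphi(y)^{1-t}$ for $x,y>0$, $t\in[0,1]$. 3. The function $y\mapsto\varphi(1/y)$ is completely monotonic and log-convex on $(0,\infty)$, and there is a non-negative measure $\tau$ supported on $[0,\infty)$ such that $\varphi(x)=\int_{[0,\infty)}e^{-t/x}\,d\tau(t)$ for all $x>0$ (with convergent integral). 4. For all $x>0$, $f(\alpha+\mu,x)>0$, $f(\beta+\mu,x)>0$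 and $$\frac{\Gamma(\alpha+\mu)\Gamma(\beta+\mu)}{\Gamma(\mu)\Gamma(\alpha+\beta+\mu)}<\frac{f(\mu,x)f(\alpha+\beta+\mu,x)}{f(\alpha+\mu,x)f(\beta+\mu,x)}<1,$$ with the convention $\Gamma(0)=+\infty$, $\Gamma(-1)=-\infty$ (so the left-hand side is read as $0$ if $\mu\in\{-1,0\}$, and as $-\infty$ if $-1<\mu<0$ and $\mu+\alpha=0$ or $\mu+\beta=0$). If $\mu+\alpha>0$ and $\mu+\beta>0$, then at $x=0$ also $f(\alpha+\mu,0)>0$, $f(\beta+\mu,0)>0$, the right inequality still holds strictly, and the left inequality becomes an equality. 5. For all $x\ge0$, $$\varphi(x)\ge\frac1{\Gamma(\mu+\alpha)\Gamma(\mu+\beta)}-\frac1{\Gamma(\mu)\Gamma(\mu+\alpha+\beta)},$$ with equality if and only if $x=0$ (here again $1/\Gamma=0$ at the poles). -/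

import Mathlib

open Set MeasureTheory
open scoped ContDiff

noncomputable section

namespace HypTuran

/-- The rising factorial `(c)_n = c (c + 1) ⋯ (c + n - 1)`. -/
def rising (c : ℝ) (n : ℕ) : ℝ := (ascPochhammer ℝ n).eval c

/-- The `n`-th term of the hypergeometric series `_pF_q(a; b; x)`. -/
def hypTerm {p q : ℕ} (a : Fin p → ℝ) (b : Fin q → ℝ) (x : ℝ) (n : ℕ) : ℝ :=
  (∏ i, rising (a i) n) / ((∏ j, rising (b j) n) * (n.factorial : ℝ)) * x ^ n

/-- The generalized hypergeometric function `_pF_q(a; b; x)`, as the sum of its series. -/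
def hyp {p q : ℕ} (a : Fin p → ℝ) (b : Fin q → ℝ) (x : ℝ) : ℝ := ∑' n, hypTerm a b x n

/-- The `n`-th term `(a)_n / (b)_n * x ^ n / (n! Γ(ν + n))` of the series of
`Γ(ν)⁻¹ _pF_{q+1}(a; ν, b; x)`. `Real.Gamma` is `0` at the poles of `Γ`,
so that `1 / Γ` has its usual value `0` there. -/
def regHypTerm {p q : ℕ} (a : Fin p → ℝ) (b : Fin q → ℝ) (ν x : ℝ) (n : ℕ) : ℝ :=
  (∏ i, rising (a i) n) / (∏ j, rising (b j) n) * x ^ n /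
    ((n.factorial : ℝ) * Real.Gamma (ν + n))

/-- The function `f(ν, x) = Γ(ν)⁻¹ _pF_{q+1}(a; ν, b; x)`, defined for all real `ν` by
its power series in `x` (this is the extension to `ν = 0, -1, -2, …`). -/
def regHyp {p q : ℕ} (a : Fin p → ℝ) (b : Fin q → ℝ) (ν x : ℝ) : ℝ :=
  ∑' n, regHypTerm a b ν x n

/-- The `k`-th elementary symmetric polynomial of `x_1, …, x_q`. -/
def elemSymm {q : ℕ} (x : Fin q → ℝ) (k : ℕ) : ℝ :=
  MvPolynomial.eval x (MvPolynomial.esymm (Fin q) ℝ k)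

/-- The chain (for `p ≤ q`, with `r = q - p`)
`e_q(b)/e_p(a) ≤ e_{q-1}(b)/e_{p-1}(a) ≤ ⋯ ≤ e_{r+1}(b)/e_1(a) ≤ e_r(b)`, where `e_0(a) = 1`. -/
def SymmetricChain {p q : ℕ} (a : Fin p → ℝ) (b : Fin q → ℝ) : Prop :=
  ∀ j : ℕ, j < p →
    elemSymm b (q - p + (j + 1)) / elemSymm a (j + 1) ≤ elemSymm b (q - p + j) / elemSymm a j

/-- Strict log-concavity of a positive function on `s`. -/
def StrictLogConcaveOn (s : Set ℝ) (f : ℝ → ℝ) : Prop :=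
  (∀ x ∈ s, 0 < f x) ∧ StrictConcaveOn ℝ s (fun x => Real.log (f x))

/-- Log-convexity of a positive function on `s`. -/
def LogConvexOn (s : Set ℝ) (f : ℝ → ℝ) : Prop :=
  (∀ x ∈ s, 0 < f x) ∧ ConvexOn ℝ s (fun x => Real.log (f x))

/-- Multiplicative convexity of a positive function on `(0, ∞)`. -/
def MultiplicativelyConvex (f : ℝ → ℝ) : Prop :=
  (∀ x, 0 < x → 0 < f x) ∧
    ∀ x y t : ℝ, 0 < x → 0 < y → 0 ≤ t → t ≤ 1 →
      f (x ^ t * y ^ (1 - t)) ≤ f x ^ t * f y ^ (1 - t)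

/-- Complete monotonicity on `(0, ∞)`: smooth, with derivatives of alternating signs. -/
def CompletelyMonotone (f : ℝ → ℝ) : Prop :=
  ContDiffOn ℝ ∞ f (Ioi 0) ∧
    ∀ (n : ℕ) (y : ℝ), 0 < y → 0 ≤ (-1 : ℝ) ^ n * iteratedDerivWithin n f (Ioi 0) y

/-- `φ_{α,β,μ}(x) = f(α+μ, x) f(β+μ, x) - f(α+β+μ, x) f(μ, x)`. -/
def turanian (f : ℝ → ℝ → ℝ) (α β μ x : ℝ) : ℝ :=
  f (α + μ) x * f (β + μ) x - f (α + β + μ) x * f μ x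

/-- The gamma function with the conventions `Γ(-1) = -∞` and `Γ(0) = +∞`. -/
def extGamma (z : ℝ) : EReal :=
  open Classical in if z = 0 then ⊤ else if z = -1 then ⊥ else ((Real.Gamma z : ℝ) : EReal)

end HypTuran

end

/-!
Write `f_n = (a)_n / (b)_n`, so that `f(ν, x) = ∑ f_n x ^ n / (n! Γ(ν + n))`.

The chain of inequalities between elementary symmetric polynomials says that the quotients of the
coefficients of `∏ (b_j + t)` and `∏ (a_i + t)` are monotone. Hence the quotient of these
polynomials is nondecreasing in `t ≥ 0` (`SymmetricChain.prod_mul_prod_le`), which means that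
`f_{n + 1} / f_n` is nonincreasing: `f` is log-concave (`risingQuot_logConcave`). Only this
property of `f_n` is used afterwards.

The coefficient `φ_m` of the Turánian is a sum over `k + l = m`. Symmetrised in `k` and `l` it
becomes `∑ f_k f_l (m choose k) symDiff k l` up to a positive factor. The weights `f_k f_l`
increase towards the middle of the antidiagonal, while `symDiff` changes sign at most once on the
way to the middle, from negative to positive (`symDiff_nonneg_step`). So the sum is at least a
positive constant times the sum for constant `f` (`exists_mul_sum_le_sum_antidiagonal`). By the
Chu–Vandermonde identity (`sum_choose_mul_symDiff`) the latter is a rising factorial times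
`1 / (Γ(α + μ + m) Γ(β + μ + m)) - 1 / (Γ(α + β + μ + m) Γ(μ + m))`, which is positive by the
log-convexity of `Γ`, or by signs if `μ + m ≤ 0`; the two exceptional coefficients are those where
one of these factors vanishes.

Everything that concerns `φ` alone follows from the nonnegativity of its coefficients: absolute
monotonicity by termwise differentiation, complete monotonicity of `φ(1 / y)` because `-d/dy`
preserves series in `1 / y` with nonnegative coefficients, multiplicative convexity from Hölder's
inequality, log-convexity of `φ(1 / y)` from multiplicative convexity and monotonicity, and the
measure `τ` from the fact that `x ^ m` is the Laplace transform at `1 / x` of the density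
`t ^ (m - 1) / (m - 1)!` (of the unit mass at `0` for `m = 0`).

Positivity of `φ` for `α = β` is strict midpoint concavity of `log f(·, x)`,
which together with continuity gives strict concavity. The lower bound in the two-sided estimate
is a comparison of the functions `Γ(ν) f(ν, x) = ∑ f_n x ^ n / (n! (ν)_n)`: for `μ > 0` it holds
coefficientwise (`pser_normCoeff_mul_lt_of_pos`), for `-1 < μ < 0` it is a matter of signs.
-/

namespace HypTuran

/-! ### Everywhere convergent power series -/

/-- The sum of the power series with real coefficients `c`. -/
noncomputable def pser (c : ℕ → ℝ) (x : ℝ) : ℝ := ∑' m, c m * x ^ m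

/-- The power series with coefficients `c` converges on all of `ℝ`. -/
def EntireCoeff (c : ℕ → ℝ) : Prop := ∀ x : ℝ, Summable fun m => c m * x ^ m

theorem EntireCoeff.abs {c : ℕ → ℝ} (hc : EntireCoeff c) (x : ℝ) :
    Summable fun m => |c m| * |x| ^ m := by
  have := (hc x).abs
  simpa [abs_mul, abs_pow] using this

theorem EntireCoeff.natCast_mul {c : ℕ → ℝ} (hc : EntireCoeff c) (x : ℝ) :
    Summable fun m => |c m| * (m * |x| ^ (m - 1)) := by
  refine Summable.of_nonneg_of_le (fun m => by positivity) (fun m => ?_)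
    (hc.abs (2 * (|x| + 1)))
  rw [abs_of_nonneg (by positivity : 0 ≤ 2 * (|x| + 1)), mul_pow]
  have h1 : (m : ℝ) ≤ 2 ^ m := by exact_mod_cast Nat.lt_two_pow_self.le
  have h2 : |x| ^ (m - 1) ≤ (|x| + 1) ^ m :=
    (pow_le_pow_left₀ (abs_nonneg x) (by linarith) _).trans
      (pow_le_pow_right₀ (by linarith [abs_nonneg x]) (by omega))
  gcongr

theorem EntireCoeff.deriv {c : ℕ → ℝ} (hc : EntireCoeff c) :
    EntireCoeff fun m => (m + 1 : ℝ) * c (m + 1) := by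
  intro x
  have := (summable_nat_add_iff 1).2 (hc.natCast_mul x)
  refine Summable.of_norm_bounded this fun m => ?_
  simp only [norm_mul, Real.norm_eq_abs, abs_pow, Nat.add_sub_cancel]
  rw [abs_of_nonneg (by positivity : (0 : ℝ) ≤ m + 1)]
  push_cast
  exact le_of_eq (by ring)

theorem hasDerivAt_pser {c : ℕ → ℝ} (hc : EntireCoeff c) (x : ℝ) :
    HasDerivAt (pser c) (pser (fun m => (m + 1 : ℝ) * c (m + 1)) x) x := by
  have h := hasDerivAt_tsum_of_isPreconnected (hc.natCast_mul (|x| + 1))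
    (Metric.isOpen_ball (x := (0 : ℝ)) (ε := |x| + 1))
    (convex_ball (0 : ℝ) (|x| + 1)).isPreconnected
    (g := fun m y => c m * y ^ m) (g' := fun m y => c m * (m * y ^ (m - 1)))
    (fun m y _ => (hasDerivAt_pow m y).const_mul (c m))
    (fun m y hy => by
      have hy' : |y| ≤ |x| + 1 := by simpa using (mem_ball_zero_iff.1 hy).le
      have hx : |(|x| + 1)| = |x| + 1 := abs_of_nonneg (by positivity)
      simp only [norm_mul, Real.norm_eq_abs, abs_pow, Nat.abs_cast, hx]
      gcongr)
    (Metric.mem_ball_self (by positivity)) (hc 0) (y := x) (by simp)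
  have hs : Summable fun m : ℕ => c m * (m * x ^ (m - 1)) := by
    refine Summable.of_norm_bounded (hc.natCast_mul x) fun m => ?_
    simp [norm_mul]
  rw [hs.tsum_eq_zero_add] at h
  convert! h using 1
  simp only [pser, CharP.cast_eq_zero, zero_mul, mul_zero, zero_add]
  refine tsum_congr fun m => ?_
  push_cast
  ring

theorem contDiff_pser {c : ℕ → ℝ} (hc : EntireCoeff c) : ContDiff ℝ ∞ (pser c) := by
  rw [contDiff_infty]
  intro n
  induction n generalizing c with
  | zero =>
    exact contDiff_zero.2
      (continuous_iff_continuousAt.2 fun x => (hasDerivAt_pser hc x).continuousAt)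
  | succ n ih =>
    have : ((n + 1 : ℕ) : WithTop ℕ∞) = (n : WithTop ℕ∞) + 1 := by push_cast; rfl
    rw [this, contDiff_succ_iff_deriv]
    refine ⟨fun x => (hasDerivAt_pser hc x).differentiableAt, by simp, ?_⟩
    rw [funext fun x => (hasDerivAt_pser hc x).deriv]
    exact ih hc.deriv

theorem pser_nonneg {c : ℕ → ℝ} (h0 : ∀ m, 0 ≤ c m) {x : ℝ} (hx : 0 ≤ x) : 0 ≤ pser c x :=
  tsum_nonneg fun m => mul_nonneg (h0 m) (pow_nonneg hx m)

theorem absolutelyMonotoneOn_pser {c : ℕ → ℝ} (hc : EntireCoeff c) (h0 : ∀ m, 0 ≤ c m) :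
    AbsolutelyMonotoneOn (pser c) (Ioi 0) := by
  refine AbsolutelyMonotoneOn.of_contDiff (contDiff_pser hc) fun n x hx => ?_
  induction n generalizing c with
  | zero => simpa using pser_nonneg h0 (le_of_lt hx)
  | succ n ih =>
    rw [iteratedDeriv_succ', funext fun x => (hasDerivAt_pser hc x).deriv]
    exact ih hc.deriv fun m => mul_nonneg (by positivity) (h0 _)

/-- `-d/dy` maps `∑ c_m y⁻ᵐ` to the series of the same kind with coefficients
`(m - 1) c_{m - 1}`. (The truncated subtraction is harmless: the terms `m = 0, 1` vanish.) -/
theorem EntireCoeff.shift {c : ℕ → ℝ} (hc : EntireCoeff c) :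
    EntireCoeff fun m => ((m - 1 : ℕ) : ℝ) * c (m - 1) := by
  intro x
  rw [← summable_nat_add_iff 2]
  refine ((hc.deriv x).mul_left (x ^ 2)).congr fun m => ?_
  simp only [Nat.add_succ_sub_one]
  push_cast
  ring

theorem pser_shift {c : ℕ → ℝ} (hc : EntireCoeff c) (x : ℝ) :
    pser (fun m => ((m - 1 : ℕ) : ℝ) * c (m - 1)) x =
      x ^ 2 * pser (fun m => (m + 1 : ℝ) * c (m + 1)) x := by
  rw [pser, ← (hc.shift x).sum_add_tsum_nat_add 2, pser, ← tsum_mul_left]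
  simp only [Finset.sum_range_succ, Finset.sum_range_zero]
  simp only [Nat.add_succ_sub_one]
  simp only [zero_tsub, CharP.cast_eq_zero, zero_mul, tsub_self, add_zero, zero_add]
  refine tsum_congr fun m => ?_
  push_cast
  ring

theorem completelyMonotone_pser_one_div {c : ℕ → ℝ} (hc : EntireCoeff c) (h0 : ∀ m, 0 ≤ c m) :
    CompletelyMonotone fun y => pser c (1 / y) := by
  constructor
  · exact (contDiff_pser hc).comp_contDiffOn
      (contDiffOn_const.div contDiffOn_id fun y hy => ne_of_gt hy)
  · intro n y hy
    induction n generalizing c with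
    | zero => simpa using pser_nonneg h0 (inv_nonneg.2 hy.le)
    | succ n ih =>
      have hd : EqOn (derivWithin (fun y => pser c (1 / y)) (Ioi 0))
          (-fun y => pser (fun m => ((m - 1 : ℕ) : ℝ) * c (m - 1)) (1 / y)) (Ioi 0) := by
        intro z hz
        have hz0 : z ≠ 0 := ne_of_gt hz
        have h2 : HasDerivAt (fun y : ℝ => 1 / y) (-(z ^ 2)⁻¹) z := by
          simpa only [one_div] using hasDerivAt_inv hz0
        have h1 := (hasDerivAt_pser hc (1 / z)).comp z h2
        rw [derivWithin_of_isOpen isOpen_Ioi hz]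
        refine h1.deriv.trans ?_
        simp only [Pi.neg_apply]
        rw [pser_shift hc]
        field_simp
      have hy' : y ∈ Ioi (0 : ℝ) := hy
      rw [iteratedDerivWithin_succ', iteratedDerivWithin_congr hd hy', iteratedDerivWithin_neg,
        pow_succ]
      have := ih hc.shift fun m => mul_nonneg (by positivity) (h0 _)
      linarith

theorem pser_pos {c : ℕ → ℝ} (hc : EntireCoeff c) (h0 : ∀ m, 0 ≤ c m) {k : ℕ} (hk : 0 < c k)
    {x : ℝ} (hx : 0 < x) : 0 < pser c x :=
  (hc x).tsum_pos (fun m => mul_nonneg (h0 m) (pow_nonneg hx.le m)) k (by positivity)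

theorem pser_mono {c : ℕ → ℝ} (hc : EntireCoeff c) (h0 : ∀ m, 0 ≤ c m) {x y : ℝ} (hx : 0 ≤ x)
    (hxy : x ≤ y) : pser c x ≤ pser c y :=
  (hc x).tsum_le_tsum (fun m => mul_le_mul_of_nonneg_left (pow_le_pow_left₀ hx hxy m) (h0 m)) (hc y)

theorem pser_zero (c : ℕ → ℝ) : pser c 0 = c 0 := by
  rw [pser, tsum_eq_single 0 fun m hm => by simp [hm]]
  simp

theorem coeff_zero_lt_pser {c : ℕ → ℝ} (hc : EntireCoeff c) (h0 : ∀ m, 0 ≤ c m) {k : ℕ}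
    (hk0 : k ≠ 0) (hk : 0 < c k) {x : ℝ} (hx : 0 < x) : c 0 < pser c x := by
  obtain ⟨j, rfl⟩ := Nat.exists_eq_succ_of_ne_zero hk0
  rw [pser, (hc x).tsum_eq_zero_add]
  have := ((summable_nat_add_iff 1).2 (hc x)).tsum_pos
    (fun m => mul_nonneg (h0 _) (pow_nonneg hx.le _)) j (by positivity)
  simpa using this

/-- Hölder's inequality in the form: a power series with nonnegative coefficients is
multiplicatively convex. It is obtained from the weighted inequality between the arithmetic and the
geometric mean, applied to the normalised terms. -/
theorem pser_rpow_mul_rpow_le {c : ℕ → ℝ} (hc : EntireCoeff c) (h0 : ∀ m, 0 ≤ c m) {k : ℕ}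
    (hk : 0 < c k) {x y t : ℝ} (hx : 0 < x) (hy : 0 < y) (ht : 0 ≤ t) (ht1 : t ≤ 1) :
    pser c (x ^ t * y ^ (1 - t)) ≤ pser c x ^ t * pser c y ^ (1 - t) := by
  have hX := pser_pos hc h0 hk hx
  have hY := pser_pos hc h0 hk hy
  set K := pser c x ^ t * pser c y ^ (1 - t) with hK
  have hKpos : 0 < K := by positivity
  have key : ∀ m, c m * (x ^ t * y ^ (1 - t)) ^ m ≤
      K * (t * (c m * x ^ m / pser c x) + (1 - t) * (c m * y ^ m / pser c y)) := by
    intro m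
    have h1 := Real.geom_mean_le_arith_mean2_weighted ht (sub_nonneg.2 ht1)
      (by positivity : 0 ≤ x ^ m / pser c x) (by positivity : 0 ≤ y ^ m / pser c y) (by ring)
    rw [Real.div_rpow (by positivity) hX.le, Real.div_rpow (by positivity) hY.le, div_mul_div_comm,
      ← hK, div_le_iff₀ hKpos] at h1
    have h2 : (x ^ t * y ^ (1 - t)) ^ m = (x ^ m) ^ t * (y ^ m) ^ (1 - t) := by
      rw [mul_pow, ← Real.rpow_natCast, ← Real.rpow_natCast, ← Real.rpow_natCast,
        ← Real.rpow_natCast, ← Real.rpow_mul hx.le, ← Real.rpow_mul hy.le, ← Real.rpow_mul hx.le,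
        ← Real.rpow_mul hy.le, mul_comm t, mul_comm (1 - t)]
    rw [h2]
    calc _ ≤ c m * ((t * (x ^ m / pser c x) + (1 - t) * (y ^ m / pser c y)) * K) :=
          mul_le_mul_of_nonneg_left h1 (h0 m)
      _ = _ := by ring
  have hsX := ((hc x).hasSum.div_const (pser c x)).mul_left t
  have hsY := ((hc y).hasSum.div_const (pser c y)).mul_left (1 - t)
  have hs := (hsX.add hsY).mul_left K
  have := hasSum_le key (hc _).hasSum hs
  refine this.trans (le_of_eq ?_)
  change K * (t * (pser c x / pser c x) + (1 - t) * (pser c y / pser c y)) = K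
  rw [div_self hX.ne', div_self hY.ne']
  ring

theorem multiplicativelyConvex_pser {c : ℕ → ℝ} (hc : EntireCoeff c) (h0 : ∀ m, 0 ≤ c m) {k : ℕ}
    (hk : 0 < c k) : MultiplicativelyConvex (pser c) :=
  ⟨fun _ hx => pser_pos hc h0 hk hx,
    fun _ _ _ hx hy ht ht1 => pser_rpow_mul_rpow_le hc h0 hk hx hy ht ht1⟩

theorem logConvexOn_pser_one_div {c : ℕ → ℝ} (hc : EntireCoeff c) (h0 : ∀ m, 0 ≤ c m) {k : ℕ}
    (hk : 0 < c k) : LogConvexOn (Ioi 0) fun y => pser c (1 / y) := by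
  refine ⟨fun y hy => pser_pos hc h0 hk (one_div_pos.2 hy), convex_Ioi 0, ?_⟩
  intro y hy z hz s t hs ht hst
  have hy : 0 < y := hy
  have hz : 0 < z := hz
  obtain rfl : t = 1 - s := by linarith
  have hw : 0 < y ^ s * z ^ (1 - s) := by positivity
  have h1 := Real.geom_mean_le_arith_mean2_weighted hs ht hy.le hz.le hst
  have h2 := pser_rpow_mul_rpow_le hc h0 hk (one_div_pos.2 hy) (one_div_pos.2 hz) hs (by linarith)
  have h3 : pser c (1 / (s * y + (1 - s) * z)) ≤ pser c ((1 / y) ^ s * (1 / z) ^ (1 - s)) := by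
    refine pser_mono hc h0 (one_div_nonneg.2 (hw.le.trans h1)) ?_
    rw [Real.div_rpow zero_le_one hy.le, Real.div_rpow zero_le_one hz.le, Real.one_rpow,
      Real.one_rpow, div_mul_div_comm, one_mul]
    exact one_div_le_one_div_of_le hw h1
  have hY := pser_pos hc h0 hk (one_div_pos.2 hy)
  have hZ := pser_pos hc h0 hk (one_div_pos.2 hz)
  have h4 := Real.log_le_log (pser_pos hc h0 hk (one_div_pos.2 (hw.trans_le h1))) (h3.trans h2)
  rw [Real.log_mul (by positivity) (by positivity), Real.log_rpow hY, Real.log_rpow hZ] at h4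
  simpa using h4

/-- The measure `t^{m-1} / (m-1)! dt` on `(0, ∞)`, or the unit mass at `0` for `m = 0`; its Laplace
transform at `1 / x` is `x ^ m`. -/
noncomputable def laplacePow : ℕ → Measure ℝ
  | 0 => Measure.dirac 0
  | m + 1 => (volume.restrict (Ioi 0)).withDensity
      fun t => ENNReal.ofReal (t ^ m / (m.factorial : ℝ))

theorem lintegral_exp_laplacePow {x : ℝ} (hx : 0 < x) (m : ℕ) :
    ∫⁻ t, ENNReal.ofReal (Real.exp (-t / x)) ∂laplacePow m = ENNReal.ofReal (x ^ m) := by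
  cases m with
  | zero => simp [laplacePow]
  | succ m =>
    have hm : (0 : ℝ) < m + 1 := by positivity
    have hg := Real.integral_rpow_mul_exp_neg_mul_Ioi hm (one_div_pos.2 hx)
    have hi : IntegrableOn (fun t : ℝ => t ^ ((m + 1 : ℝ) - 1) * Real.exp (-(1 / x * t)))
        (Ioi 0) := by
      by_contra h
      rw [integral_undef h] at hg
      have : 0 < (1 / (1 / x)) ^ (m + 1 : ℝ) * Real.Gamma (m + 1) := by
        have := Real.Gamma_pos_of_pos hm
        positivity
      exact this.ne hg
    rw [laplacePow, lintegral_withDensity_eq_lintegral_mul _ (by fun_prop) (by fun_prop)]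
    have h1 : ∫⁻ t in Ioi 0, ((fun t : ℝ => ENNReal.ofReal (t ^ m / (m.factorial : ℝ))) *
        fun t => ENNReal.ofReal (Real.exp (-t / x))) t =
        ∫⁻ t in Ioi (0 : ℝ), ENNReal.ofReal
          ((m.factorial : ℝ)⁻¹ * (t ^ ((m + 1 : ℝ) - 1) * Real.exp (-(1 / x * t)))) := by
      refine setLIntegral_congr_fun measurableSet_Ioi fun t ht => ?_
      have ht : 0 < t := ht
      simp only [Pi.mul_apply]
      rw [← ENNReal.ofReal_mul (by positivity)]
      congr 1
      rw [add_sub_cancel_right, Real.rpow_natCast]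
      have : -t / x = -(1 / x * t) := by ring
      rw [this]
      ring
    rw [h1, ← ofReal_integral_eq_lintegral_ofReal (hi.const_mul _)]
    · rw [integral_const_mul, hg]
      congr 1
      have : (m : ℝ) + 1 = ((m + 1 : ℕ) : ℝ) := by push_cast; ring
      rw [Real.Gamma_nat_eq_factorial, one_div_one_div, this, Real.rpow_natCast]
      field_simp
    · filter_upwards [ae_restrict_mem measurableSet_Ioi] with t ht
      have ht : 0 < t := ht
      positivity

theorem laplacePow_Iio (m : ℕ) : laplacePow m (Iio 0) = 0 := by
  cases m with
  | zero => simp [laplacePow]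
  | succ m =>
    refine withDensity_absolutelyContinuous _ _ ?_
    rw [Measure.restrict_apply measurableSet_Iio]
    have : Iio (0 : ℝ) ∩ Ioi 0 = ∅ := by
      ext t
      simp only [mem_inter_iff, mem_Iio, mem_Ioi, mem_empty_iff_false, iff_false]
      exact fun h => lt_asymm h.1 h.2
    simp [this]

theorem exists_measure_pser {c : ℕ → ℝ} (hc : EntireCoeff c) (h0 : ∀ m, 0 ≤ c m) :
    ∃ τ : Measure ℝ, τ (Iio 0) = 0 ∧ ∀ x : ℝ, 0 < x →
      IntegrableOn (fun t => Real.exp (-t / x)) (Ici 0) τ ∧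
      pser c x = ∫ t in Ici 0, Real.exp (-t / x) ∂τ := by
  refine ⟨Measure.sum fun m => ENNReal.ofReal (c m) • laplacePow m, ?_, fun x hx => ?_⟩
  · rw [Measure.sum_apply _ measurableSet_Iio]
    simp [laplacePow_Iio]
  · set τ := Measure.sum fun m => ENNReal.ofReal (c m) • laplacePow m with hτ
    have hτ0 : τ (Iio 0) = 0 := by
      rw [hτ, Measure.sum_apply _ measurableSet_Iio]
      simp [laplacePow_Iio]
    have hτr : τ.restrict (Ici 0) = τ := by
      rw [Measure.restrict_eq_self_of_ae_mem]
      rw [ae_iff]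
      convert hτ0 using 2
      ext t
      simp
    have hl : ∫⁻ t, ENNReal.ofReal (Real.exp (-t / x)) ∂τ = ENNReal.ofReal (pser c x) := by
      rw [hτ, lintegral_sum_measure]
      simp only [lintegral_smul_measure, lintegral_exp_laplacePow hx, smul_eq_mul]
      rw [pser, ENNReal.ofReal_tsum_of_nonneg _ (hc x)]
      · exact tsum_congr fun m => (ENNReal.ofReal_mul (h0 m)).symm
      · exact fun m => mul_nonneg (h0 m) (pow_nonneg hx.le m)
    rw [IntegrableOn, hτr]
    constructor
    · refine (lintegral_ofReal_ne_top_iff_integrable (by fun_prop)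
        (Filter.Eventually.of_forall fun t => (Real.exp_pos _).le)).1 ?_
      rw [hl]
      exact ENNReal.ofReal_ne_top
    · rw [integral_eq_lintegral_of_nonneg_ae
        (Filter.Eventually.of_forall fun t => (Real.exp_pos _).le) (by fun_prop), hl,
        ENNReal.toReal_ofReal (pser_nonneg h0 hx.le)]

/-! ### The reciprocal gamma function -/

/-- The reciprocal gamma function. The value `Real.Gamma z = 0` at the poles makes this the
usual entire function on the whole real line. -/
noncomputable def invGamma (z : ℝ) : ℝ := (Real.Gamma z)⁻¹

theorem invGamma_eq_mul (z : ℝ) : invGamma z = z * invGamma (z + 1) := by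
  unfold invGamma
  rcases eq_or_ne z 0 with rfl | hz
  · simp
  · rw [Real.Gamma_add_one hz, mul_inv, mul_inv_cancel_left₀ hz]

theorem invGamma_pos {z : ℝ} (hz : 0 < z) : 0 < invGamma z := inv_pos.2 (Real.Gamma_pos_of_pos hz)

theorem invGamma_nonneg {z : ℝ} (hz : 0 ≤ z) : 0 ≤ invGamma z :=
  inv_nonneg.2 (Real.Gamma_nonneg_of_nonneg hz)

theorem invGamma_zero : invGamma 0 = 0 := by simp [invGamma]

theorem invGamma_neg_one : invGamma (-1) = 0 := by
  rw [invGamma_eq_mul, neg_add_cancel, invGamma_zero, mul_zero]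

theorem invGamma_neg_of_mem {z : ℝ} (h : -1 < z) (h0 : z < 0) : invGamma z < 0 := by
  rw [invGamma_eq_mul]
  exact mul_neg_of_neg_of_pos h0 (invGamma_pos (by linarith))

theorem Gamma_mul_Gamma_le {μ α β : ℝ} (hμ : 0 < μ) (hα : 0 < α) (hβ : 0 < β) :
    Real.Gamma (μ + α) * Real.Gamma (μ + β) ≤ Real.Gamma μ * Real.Gamma (μ + α + β) := by
  have hab : α + β ≠ 0 := by positivity
  have hM : μ + α + β ∈ Ioi (0 : ℝ) := add_pos (add_pos hμ hα) hβ
  have h1 := Real.convexOn_log_Gamma.2 (mem_Ioi.2 hμ) hM (div_nonneg hβ.le (add_pos hα hβ).le)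
    (div_nonneg hα.le (add_pos hα hβ).le) (by field_simp; ring)
  have h2 := Real.convexOn_log_Gamma.2 (mem_Ioi.2 hμ) hM (div_nonneg hα.le (add_pos hα hβ).le)
    (div_nonneg hβ.le (add_pos hα hβ).le) (by field_simp)
  have e1 : (β / (α + β)) • μ + (α / (α + β)) • (μ + α + β) = μ + α := by
    simp only [smul_eq_mul]; field_simp; ring
  have e2 : (α / (α + β)) • μ + (β / (α + β)) • (μ + α + β) = μ + β := by
    simp only [smul_eq_mul]; field_simp; ring
  rw [e1] at h1
  rw [e2] at h2
  simp only [Function.comp, smul_eq_mul] at h1 h2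
  have g0 := Real.Gamma_pos_of_pos hμ
  have g1 := Real.Gamma_pos_of_pos (add_pos hμ hα)
  have g2 := Real.Gamma_pos_of_pos (add_pos hμ hβ)
  have g3 := Real.Gamma_pos_of_pos (add_pos (add_pos hμ hα) hβ)
  rw [← Real.log_le_log_iff (by positivity) (by positivity), Real.log_mul g1.ne' g2.ne',
    Real.log_mul g0.ne' g3.ne']
  have hs : β / (α + β) + α / (α + β) = 1 := by field_simp; ring
  calc _ ≤ _ := add_le_add h1 h2
    _ = (β / (α + β) + α / (α + β)) *
        (Real.log (Real.Gamma μ) + Real.log (Real.Gamma (μ + α + β))) := by ring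
    _ = _ := by rw [hs, one_mul]

/-- Strictness comes from the recurrence: the quotient of the two sides at `μ` is
`μ (μ + α + β) / ((μ + α) (μ + β)) < 1` times the one at `μ + 1`, which is at most `1` by the
log-convexity of `Γ`. -/
theorem invGamma_mul_lt_of_pos {μ α β : ℝ} (hμ : 0 < μ) (hα : 0 < α) (hβ : 0 < β) :
    invGamma (μ + α + β) * invGamma μ < invGamma (μ + α) * invGamma (μ + β) := by
  have h := Gamma_mul_Gamma_le (show 0 < μ + 1 by linarith) hα hβ
  have g0 := invGamma_pos (show 0 < μ + 1 by linarith)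
  have g1 := invGamma_pos (show 0 < μ + α + 1 by linarith)
  have g2 := invGamma_pos (show 0 < μ + β + 1 by linarith)
  have g3 := invGamma_pos (show 0 < μ + α + β + 1 by linarith)
  have h' : invGamma (μ + α + β + 1) * invGamma (μ + 1) ≤
      invGamma (μ + α + 1) * invGamma (μ + β + 1) := by
    have := Real.Gamma_pos_of_pos (show 0 < μ + α + 1 by linarith)
    have := Real.Gamma_pos_of_pos (show 0 < μ + β + 1 by linarith)
    simp only [invGamma]
    rw [← mul_inv, ← mul_inv]
    refine inv_anti₀ (by positivity) ?_
    convert! h using 1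
    · congr 2 <;> ring
    · rw [mul_comm]; congr 2; ring
  rw [invGamma_eq_mul μ, invGamma_eq_mul (μ + α), invGamma_eq_mul (μ + β),
    invGamma_eq_mul (μ + α + β)]
  calc _ = (μ + α + β) * μ * (invGamma (μ + α + β + 1) * invGamma (μ + 1)) := by ring
    _ ≤ (μ + α + β) * μ * (invGamma (μ + α + 1) * invGamma (μ + β + 1)) := by gcongr
    _ < (μ + α) * (μ + β) * (invGamma (μ + α + 1) * invGamma (μ + β + 1)) := by
        gcongr ?_ * _
        nlinarith [mul_pos hα hβ]
    _ = _ := by ring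

theorem invGamma_mul_lt {μ α β : ℝ} (hμ : -1 ≤ μ) (hα : 0 < α) (hβ : 0 < β) (h1 : 0 ≤ μ + α)
    (h2 : 0 ≤ μ + β) (h : ¬(μ = -1 ∧ (α = 1 ∨ β = 1))) :
    invGamma (α + β + μ) * invGamma μ < invGamma (α + μ) * invGamma (β + μ) := by
  have e0 : α + β + μ = μ + α + β := by ring
  rw [e0, add_comm α μ, add_comm β μ]
  rcases lt_trichotomy μ 0 with h0 | rfl | h0
  · rcases hμ.lt_or_eq with hm | rfl
    · exact (mul_neg_of_pos_of_neg (invGamma_pos (by linarith))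
        (invGamma_neg_of_mem hm h0)).trans_le (mul_nonneg (invGamma_nonneg h1) (invGamma_nonneg h2))
    · rw [invGamma_neg_one, mul_zero]
      have ha : α ≠ 1 := fun ha => h ⟨rfl, Or.inl ha⟩
      have hb : β ≠ 1 := fun hb => h ⟨rfl, Or.inr hb⟩
      exact mul_pos (invGamma_pos (lt_of_le_of_ne h1 fun e => ha (by linarith)))
        (invGamma_pos (lt_of_le_of_ne h2 fun e => hb (by linarith)))
  · rw [invGamma_zero, mul_zero]
    exact mul_pos (invGamma_pos (by linarith)) (invGamma_pos (by linarith))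
  · exact invGamma_mul_lt_of_pos h0 hα hβ

theorem invGamma_mul_le {y a b : ℝ} (hy : 0 ≤ y) (ha : 0 ≤ a) (hb : 0 ≤ b) :
    invGamma (y + a + b) * invGamma y ≤ invGamma (y + a) * invGamma (y + b) := by
  rcases ha.eq_or_lt with rfl | ha
  · rw [add_zero, mul_comm]
  rcases hb.eq_or_lt with rfl | hb
  · rw [add_zero, add_zero]
  rcases hy.eq_or_lt with rfl | hy
  · rw [invGamma_zero, mul_zero]
    exact mul_nonneg (invGamma_nonneg (by linarith)) (invGamma_nonneg (by linarith))
  · exact (invGamma_mul_lt_of_pos hy ha hb).le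

theorem rising_succ (c : ℝ) (n : ℕ) : rising c (n + 1) = rising c n * (c + n) :=
  ascPochhammer_succ_eval n c

theorem rising_zero (c : ℝ) : rising c 0 = 1 := by simp [rising]

theorem rising_pos {c : ℝ} (hc : 0 < c) (n : ℕ) : 0 < rising c n := ascPochhammer_pos n c hc

/-- The Chu–Vandermonde identity in terms of the reciprocal gamma function. -/
theorem sum_choose_mul_invGamma (A B : ℝ) (m : ℕ) :
    ∑ ij ∈ Finset.HasAntidiagonal.antidiagonal m,
        (m.choose ij.1 : ℝ) * (invGamma (A + ij.1) * invGamma (B + ij.2)) =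
      rising (A + B + m - 1) m * (invGamma (A + m) * invGamma (B + m)) := by
  induction m generalizing A B with
  | zero => simp [rising_zero]
  | succ m ih =>
    rw [Finset.sum_antidiagonal_choose_succ_mul (fun i j => invGamma (A + i) * invGamma (B + j))]
    have h1 := ih A (B + 1)
    have h2 := ih (A + 1) B
    have h1' : ∑ ij ∈ Finset.HasAntidiagonal.antidiagonal m, (m.choose ij.1 : ℝ) *
        (invGamma (A + ij.1) * invGamma (B + ((ij.2 + 1 : ℕ) : ℝ))) =
        rising (A + (B + 1) + m - 1) m * (invGamma (A + m) * invGamma (B + 1 + m)) := by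
      rw [← h1]
      refine Finset.sum_congr rfl fun ij _ => ?_
      push_cast
      congr 3; ring
    have h2' : ∑ ij ∈ Finset.HasAntidiagonal.antidiagonal m, (m.choose ij.2 : ℝ) *
        (invGamma (A + ((ij.1 + 1 : ℕ) : ℝ)) * invGamma (B + ij.2)) =
        rising (A + 1 + B + m - 1) m * (invGamma (A + 1 + m) * invGamma (B + m)) := by
      rw [← h2]
      refine Finset.sum_congr rfl fun ij hij => ?_
      rw [← Finset.HasAntidiagonal.mem_antidiagonal.1 hij, Nat.choose_symm_add]
      push_cast
      congr 3; ring
    rw [h1', h2']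
    have e1 : A + (B + 1) + m - 1 = A + B + m := by ring
    have e2 : A + 1 + B + m - 1 = A + B + m := by ring
    have e3 : A + B + ((m + 1 : ℕ) : ℝ) - 1 = A + B + m := by push_cast; ring
    have e4 : A + ((m + 1 : ℕ) : ℝ) = A + m + 1 := by push_cast; ring
    have e5 : B + ((m + 1 : ℕ) : ℝ) = B + m + 1 := by push_cast; ring
    have e6 : A + 1 + m = A + m + 1 := by ring
    have e7 : B + 1 + m = B + m + 1 := by ring
    rw [e1, e2, e3, e4, e5, e6, e7, rising_succ, invGamma_eq_mul (A + m), invGamma_eq_mul (B + m)]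
    ring

/-! ### Sums over an antidiagonal with one change of sign -/

/-- If `w` changes sign once, from `-` to `+`, on the lower half `k ≤ l` of the antidiagonal
`k + l = m`, and `c` is nondecreasing there, then `c` may be replaced by one of its values in a
lower bound for `∑ c w`. -/
theorem exists_mul_sum_le_sum_antidiagonal {c w : ℕ → ℕ → ℝ} (hc : ∀ k l, 0 < c k l)
    (hcs : ∀ k l, c k l = c l k) (hws : ∀ k l, w k l = w l k)
    (hcm : ∀ k l, k + 1 ≤ l → c k (l + 1) ≤ c (k + 1) l)
    (hwm : ∀ k l, k + 1 ≤ l → 0 ≤ w k (l + 1) → 0 ≤ w (k + 1) l) (m : ℕ) :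
    ∃ C, 0 < C ∧ C * ∑ ij ∈ Finset.HasAntidiagonal.antidiagonal m, w ij.1 ij.2 ≤
      ∑ ij ∈ Finset.HasAntidiagonal.antidiagonal m, c ij.1 ij.2 * w ij.1 ij.2 := by
  have hc' : ∀ k k', k ≤ k' → 2 * k' ≤ m → c k (m - k) ≤ c k' (m - k') := by
    intro k k' hk
    induction k', hk using Nat.le_induction with
    | base => exact fun _ => le_rfl
    | succ n hn ih =>
      intro h
      have := hcm n (m - (n + 1)) (by omega)
      rw [show m - (n + 1) + 1 = m - n by omega] at this
      exact (ih (by omega)).trans this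
  have hw' : ∀ k k', k ≤ k' → 2 * k' ≤ m → 0 ≤ w k (m - k) → 0 ≤ w k' (m - k') := by
    intro k k' hk
    induction k', hk using Nat.le_induction with
    | base => exact fun _ h => h
    | succ n hn ih =>
      intro h h0
      have := hwm n (m - (n + 1)) (by omega)
      rw [show m - (n + 1) + 1 = m - n by omega] at this
      exact this (ih (by omega) h0)
  obtain ⟨k₀, hk₀, hC⟩ : ∃ k₀, 2 * k₀ ≤ m ∧ ∀ k, 2 * k ≤ m →
      c k₀ (m - k₀) * w k (m - k) ≤ c k (m - k) * w k (m - k) := by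
    classical
    by_cases hex : ∃ k, 2 * k ≤ m ∧ 0 ≤ w k (m - k)
    · refine ⟨Nat.find hex, (Nat.find_spec hex).1, fun k hk => ?_⟩
      rcases lt_or_ge k (Nat.find hex) with hlt | hge
      · have hneg : w k (m - k) < 0 := by
          by_contra! h
          exact Nat.find_min hex hlt ⟨hk, h⟩
        exact mul_le_mul_of_nonpos_right (hc' _ _ hlt.le (Nat.find_spec hex).1) hneg.le
      · exact mul_le_mul_of_nonneg_right (hc' _ _ hge hk) (hw' _ _ hge hk (Nat.find_spec hex).2)
    · push Not at hex
      exact ⟨m / 2, by omega, fun k hk =>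
        mul_le_mul_of_nonpos_right (hc' _ _ (by omega) (by omega)) (hex k hk).le⟩
  refine ⟨c k₀ (m - k₀), hc _ _, ?_⟩
  rw [Finset.mul_sum]
  refine Finset.sum_le_sum fun ij hij => ?_
  obtain ⟨i, j⟩ := ij
  obtain rfl : i + j = m := Finset.HasAntidiagonal.mem_antidiagonal.1 hij
  rcases le_total i j with h | h
  · simpa using hC i (by omega)
  · have := hC j (by omega)
    rw [Nat.add_sub_cancel] at this
    simp only
    rwa [hcs i j, hws i j]

/-- The symmetrised difference of products of reciprocal gamma functions that occurs in the
coefficients of the Turánian. -/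
noncomputable def symDiff (α β μ : ℝ) (k l : ℕ) : ℝ :=
  invGamma (α + μ + k) * invGamma (β + μ + l) + invGamma (α + μ + l) * invGamma (β + μ + k) -
    (invGamma (α + β + μ + k) * invGamma (μ + l) + invGamma (α + β + μ + l) * invGamma (μ + k))

theorem symDiff_comm (α β μ : ℝ) (k l : ℕ) : symDiff α β μ k l = symDiff α β μ l k := by
  unfold symDiff; ring

theorem invGamma_exchange {x y : ℝ} (hxy : y ≤ x) {k l : ℕ} (hkl : k ≤ l) (hy : 0 ≤ y + k) :
    invGamma (x + l) * invGamma (y + k) ≤ invGamma (x + k) * invGamma (y + l) := by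
  have hkl' : (k : ℝ) ≤ l := by exact_mod_cast hkl
  have := invGamma_mul_le hy (sub_nonneg.2 hxy) (sub_nonneg.2 hkl')
  rwa [show y + k + (x - y) + (l - k) = x + l by ring, show y + k + (x - y) = x + k by ring,
    show y + k + (l - k : ℝ) = y + l by ring] at this

/-- The elementary inequality behind `symDiff_nonneg_step`, with `w = μ + l`. After expanding, the
products `r * u`, `r * v` exceed `s * v`, `s * u`, and so do their factors, because
`1 / w - 1 / (w + δ)` is decreasing in `w`. -/
theorem weighted_inv_lt {w α β r s u v : ℝ} (hw : 0 < w) (hα : 0 < α) (hβ : 0 < β)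
    (hru : 0 < r * u) (hrv : 0 < r * v) (h1 : s * v ≤ r * u) (h2 : s * u ≤ r * v) :
    (u / (w + β) + v / (w + α)) * (r + s) < (r / w + s / (w + α + β)) * (u + v) := by
  have key : ∀ {γ δ : ℝ}, 0 < γ → 0 < δ → 0 ≤ 1 / (w + γ) - 1 / (w + γ + δ) ∧
      1 / (w + γ) - 1 / (w + γ + δ) < 1 / w - 1 / (w + δ) := by
    intro γ δ hγ hδ
    constructor
    · exact sub_nonneg.2 (one_div_le_one_div_of_le (by positivity) (by linarith))
    · rw [div_sub_div _ _ (by positivity) (by positivity), div_sub_div _ _ (by positivity)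
        (by positivity)]
      have : 1 * (w + γ + δ) - (w + γ) * 1 = δ := by ring
      have h' : 1 * (w + δ) - w * 1 = δ := by ring
      rw [this, h']
      have : w * (w + δ) < (w + γ) * (w + γ + δ) := by nlinarith [mul_pos hγ hδ, mul_pos hγ hw]
      gcongr
  obtain ⟨p0, p1⟩ := key hα hβ
  obtain ⟨q0, q1⟩ := key hβ hα
  have a1 := (mul_le_mul_of_nonneg_right h1 p0).trans_lt (mul_lt_mul_of_pos_left p1 hru)
  have a2 := (mul_le_mul_of_nonneg_right h2 q0).trans_lt (mul_lt_mul_of_pos_left q1 hrv)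
  rw [show w + β + α = w + α + β by ring] at a2
  have : (r / w + s / (w + α + β)) * (u + v) - (u / (w + β) + v / (w + α)) * (r + s) =
      (r * u * (1 / w - 1 / (w + β)) - s * v * (1 / (w + α) - 1 / (w + α + β))) +
      (r * v * (1 / w - 1 / (w + α)) - s * u * (1 / (w + β) - 1 / (w + α + β))) := by ring
  linarith

/-- Along the antidiagonal, `symDiff` has at most one change of sign towards the middle, from `-` to
`+`: the quotient of its second by its first sum of products decreases. -/
theorem symDiff_nonneg_step {α β μ : ℝ} (hμ : -1 ≤ μ) (hα : 0 < α) (hβ : 0 < β) (h1 : 0 ≤ μ + α)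
    (h2 : 0 ≤ μ + β) {k l : ℕ} (hkl : k + 1 ≤ l) (h : 0 ≤ symDiff α β μ k (l + 1)) :
    0 ≤ symDiff α β μ (k + 1) l := by
  have hk0 : (0 : ℝ) ≤ k := k.cast_nonneg
  rcases hkl.eq_or_lt with rfl | hlt
  -- In the middle of the antidiagonal `symDiff` is nonnegative regardless of `h`; this case is
  -- separate because `μ + l` may vanish there.
  · have h3 : ¬(μ + (k + 1 : ℕ) = -1 ∧ (α = 1 ∨ β = 1)) := by
      push_cast
      exact fun h => absurd h.1 (by linarith)
    have := invGamma_mul_lt (μ := μ + (k + 1 : ℕ)) (by push_cast; linarith) hα hβ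
      (by push_cast; linarith) (by push_cast; linarith) h3
    simp only [← add_assoc] at this
    unfold symDiff
    linarith
  · have hl : (k : ℝ) + 2 ≤ l := by exact_mod_cast hlt
    have hw : 0 < μ + l := by linarith
    set u := invGamma (α + μ + (k + 1 : ℕ)) * invGamma (β + μ + l) with hu
    set v := invGamma (α + μ + l) * invGamma (β + μ + (k + 1 : ℕ)) with hv
    set r := invGamma (α + β + μ + (k + 1 : ℕ)) * invGamma (μ + l) with hr
    set s := invGamma (α + β + μ + l) * invGamma (μ + (k + 1 : ℕ)) with hs
    have hk1 : ((k + 1 : ℕ) : ℝ) = k + 1 := by push_cast; ring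
    have hl1 : ((l + 1 : ℕ) : ℝ) = l + 1 := by push_cast; ring
    have pu : 0 < u := mul_pos (invGamma_pos (by rw [hk1]; linarith)) (invGamma_pos (by linarith))
    have pv : 0 < v := mul_pos (invGamma_pos (by linarith)) (invGamma_pos (by rw [hk1]; linarith))
    have pr : 0 < r := mul_pos (invGamma_pos (by rw [hk1]; linarith)) (invGamma_pos hw)
    -- Cross-ratios of the products at `(k + 1, l)`.
    have x1 := invGamma_exchange (show β + μ ≤ α + β + μ by linarith) hkl (by rw [hk1]; linarith)
    have x2 := invGamma_exchange (show μ ≤ α + μ by linarith) hkl (by rw [hk1]; linarith)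
    have x3 := invGamma_exchange (show α + μ ≤ α + β + μ by linarith) hkl (by rw [hk1]; linarith)
    have x4 := invGamma_exchange (show μ ≤ β + μ by linarith) hkl (by rw [hk1]; linarith)
    have y1 : s * v ≤ r * u := by
      have := mul_le_mul x1 x2 (mul_nonneg (invGamma_nonneg (by linarith))
        (invGamma_nonneg (by rw [hk1]; linarith)))
        (mul_nonneg (invGamma_nonneg (by rw [hk1]; linarith)) (invGamma_nonneg (by linarith)))
      rw [hr, hs, hu, hv]
      linarith
    have y2 : s * u ≤ r * v := by
      have := mul_le_mul x3 x4 (mul_nonneg (invGamma_nonneg (by linarith))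
        (invGamma_nonneg (by rw [hk1]; linarith)))
        (mul_nonneg (invGamma_nonneg (by rw [hk1]; linarith)) (invGamma_nonneg (by linarith)))
      rw [hr, hs, hu, hv]
      linarith
    have key := weighted_inv_lt hw hα hβ (mul_pos pr pu) (mul_pos pr pv) y1 y2
    -- The products at `(k, l + 1)` in terms of those at `(k + 1, l)`.
    set T := α + β + 2 * μ + k + l with hT
    have hT0 : 0 < T := by linarith
    have step : ∀ {x y : ℝ}, 0 < y + l → x + y + k + l = T →
        invGamma (x + k) * invGamma (y + (l + 1 : ℕ)) =
          invGamma (x + (k + 1 : ℕ)) * invGamma (y + l) * (T / (y + l) - 1) := by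
      intro x y hy hxy
      have e : T / (y + l) - 1 = (x + k) / (y + l) := by rw [← hxy]; field_simp; ring
      rw [e, invGamma_eq_mul (x + k), invGamma_eq_mul (y + l), hk1, hl1, ← add_assoc, ← add_assoc]
      field_simp
    have eu := step (x := α + μ) (y := β + μ) (by linarith) (by rw [hT]; ring)
    have ev := step (x := β + μ) (y := α + μ) (by linarith) (by rw [hT]; ring)
    have er := step (x := α + β + μ) (y := μ) (by linarith) (by rw [hT]; ring)
    have es := step (x := μ) (y := α + β + μ) (by linarith) (by rw [hT]; ring)
    have nu : 0 ≤ u * (T / (β + μ + l) - 1) := eu ▸ mul_nonneg (invGamma_nonneg (by linarith))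
      (invGamma_nonneg (by rw [hl1]; linarith))
    have nv : 0 ≤ v * (T / (α + μ + l) - 1) := by
      rw [hv, mul_comm (invGamma (α + μ + l)), ← ev]
      exact mul_nonneg (invGamma_nonneg (by linarith)) (invGamma_nonneg (by rw [hl1]; linarith))
    have hsd : symDiff α β μ k (l + 1) =
        u * (T / (β + μ + l) - 1) + v * (T / (α + μ + l) - 1) -
        (r * (T / (μ + l) - 1) + s * (T / (α + β + μ + l) - 1)) := by
      unfold symDiff
      rw [mul_comm (invGamma (α + μ + (l + 1 : ℕ))),
        mul_comm (invGamma (α + β + μ + (l + 1 : ℕ))), eu, ev, er, es,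
        mul_comm (invGamma (β + μ + (k + 1 : ℕ))), mul_comm (invGamma (μ + (k + 1 : ℕ)))]
    rw [hsd] at h
    rw [show β + μ + l = μ + l + β by ring] at h nu
    rw [show α + μ + l = μ + l + α by ring] at h nv
    rw [show α + β + μ + l = μ + l + α + β by ring] at h
    change 0 ≤ u + v - (r + s)
    clear_value u v r s T
    set X := u / (μ + l + β) + v / (μ + l + α) with hX
    set Y := r / (μ + l) + s / (μ + l + α + β) with hY
    have hTX : u * (T / (μ + l + β) - 1) + v * (T / (μ + l + α) - 1) = T * X - (u + v) := by
      rw [hX]; ring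
    have hTY : r * (T / (μ + l) - 1) + s * (T / (μ + l + α + β) - 1) = T * Y - (r + s) := by
      rw [hY]; ring
    rw [hTX, hTY] at h
    -- The first sum at `(k, l + 1)`. It vanishes if `k = 0` and `μ + α = μ + β = 0`, so that the
    -- strict inequality `key` is needed to conclude.
    have n2 : 0 ≤ T * X - (u + v) := hTX ▸ add_nonneg nu nv
    have k1 := mul_lt_mul_of_pos_left key hT0
    clear_value X Y
    by_contra! hneg
    have k2 : (T * Y - (r + s)) * (u + v) ≤ (T * X - (u + v)) * (u + v) :=
      mul_le_mul_of_nonneg_right (by linarith) (by positivity)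
    have k3 : 0 ≤ (T * X - (u + v)) * (r + s - (u + v)) := mul_nonneg n2 (by linarith)
    linarith

/-! ### The coefficients of the Turánian -/

/-- The coefficient of `x ^ m` in the Turánian of `∑ f_n x ^ n / (n! Γ(ν + n))`. -/
noncomputable def turanianCoeff (f : ℕ → ℝ) (α β μ : ℝ) (m : ℕ) : ℝ :=
  ∑ ij ∈ Finset.HasAntidiagonal.antidiagonal m,
    f ij.1 / (ij.1.factorial : ℝ) * (f ij.2 / (ij.2.factorial : ℝ)) *
      (invGamma (α + μ + ij.1) * invGamma (β + μ + ij.2) -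
        invGamma (α + β + μ + ij.1) * invGamma (μ + ij.2))

theorem two_mul_turanianCoeff (f : ℕ → ℝ) (α β μ : ℝ) (m : ℕ) :
    2 * turanianCoeff f α β μ m = (m.factorial : ℝ)⁻¹ *
      ∑ ij ∈ Finset.HasAntidiagonal.antidiagonal m,
        f ij.1 * f ij.2 * (((ij.1 + ij.2).choose ij.1 : ℝ) * symDiff α β μ ij.1 ij.2) := by
  rw [two_mul]
  nth_rewrite 2 [turanianCoeff]
  rw [← Finset.Nat.sum_antidiagonal_swap, turanianCoeff, ← Finset.sum_add_distrib, Finset.mul_sum]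
  refine Finset.sum_congr rfl fun ij hij => ?_
  obtain ⟨i, j⟩ := ij
  obtain rfl : i + j = m := Finset.HasAntidiagonal.mem_antidiagonal.1 hij
  have h : (((i + j).choose i : ℕ) : ℝ) * i.factorial * j.factorial = (i + j).factorial := by
    rw [Nat.choose_symm_add]
    exact_mod_cast Nat.add_choose_mul_factorial_mul_factorial i j
  have hi : (i.factorial : ℝ) ≠ 0 := by positivity
  have hj : (j.factorial : ℝ) ≠ 0 := by positivity
  have hij : (((i + j).choose i : ℕ) : ℝ) ≠ 0 := by
    have := Nat.choose_pos (Nat.le_add_right i j)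
    positivity
  simp only [Prod.fst_swap, Prod.snd_swap]
  rw [← h, symDiff]
  field_simp
  ring

theorem sum_choose_mul_symDiff (α β μ : ℝ) (m : ℕ) :
    ∑ ij ∈ Finset.HasAntidiagonal.antidiagonal m,
        (((ij.1 + ij.2).choose ij.1 : ℝ) * symDiff α β μ ij.1 ij.2) =
      2 * (rising (2 * μ + α + β + m - 1) m *
        (invGamma (α + (μ + m)) * invGamma (β + (μ + m)) -
          invGamma (α + β + (μ + m)) * invGamma (μ + m))) := by
  have h1 := sum_choose_mul_invGamma (α + μ) (β + μ) m
  have h2 := sum_choose_mul_invGamma (β + μ) (α + μ) m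
  have h3 := sum_choose_mul_invGamma (α + β + μ) μ m
  have h4 := sum_choose_mul_invGamma μ (α + β + μ) m
  have e1 : α + μ + (β + μ) + m - 1 = 2 * μ + α + β + m - 1 := by ring
  have e2 : β + μ + (α + μ) + m - 1 = 2 * μ + α + β + m - 1 := by ring
  have e3 : α + β + μ + μ + m - 1 = 2 * μ + α + β + m - 1 := by ring
  have e4 : μ + (α + β + μ) + m - 1 = 2 * μ + α + β + m - 1 := by ring
  rw [e1] at h1
  rw [e2] at h2
  rw [e3] at h3
  rw [e4] at h4
  rw [← add_assoc, ← add_assoc, ← add_assoc]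
  calc _ = ∑ ij ∈ Finset.HasAntidiagonal.antidiagonal m,
        ((m.choose ij.1 : ℝ) * (invGamma (α + μ + ij.1) * invGamma (β + μ + ij.2)) +
          (m.choose ij.1 : ℝ) * (invGamma (β + μ + ij.1) * invGamma (α + μ + ij.2)) -
          ((m.choose ij.1 : ℝ) * (invGamma (α + β + μ + ij.1) * invGamma (μ + ij.2)) +
          (m.choose ij.1 : ℝ) * (invGamma (μ + ij.1) * invGamma (α + β + μ + ij.2)))) := by
        refine Finset.sum_congr rfl fun ij hij => ?_
        rw [Finset.HasAntidiagonal.mem_antidiagonal.1 hij, symDiff]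
        ring
    _ = _ := by
        rw [Finset.sum_sub_distrib, Finset.sum_add_distrib, Finset.sum_add_distrib, h1, h2, h3, h4]
        ring

section Positivity

variable {f : ℕ → ℝ} {α β μ : ℝ}

theorem turanianCoeff_zero (f : ℕ → ℝ) (α β μ : ℝ) : turanianCoeff f α β μ 0 =
    f 0 * f 0 * (invGamma (α + μ) * invGamma (β + μ) - invGamma (α + β + μ) * invGamma μ) := by
  simp [turanianCoeff]

/-- The weights `f_k f_l` increase towards the middle of the antidiagonal when `f` is log-concave,
so the single change of sign of `symDiff` reduces the positivity of the coefficients to the case of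
constant `f`, which is the Chu–Vandermonde identity. -/
theorem turanianCoeff_pos (hf : ∀ n, 0 < f n)
    (hlc : ∀ k l, k ≤ l → f k * f (l + 1) ≤ f (k + 1) * f l)
    (hμ : -1 ≤ μ) (hα : 0 < α) (hβ : 0 < β) (h1 : 0 ≤ μ + α) (h2 : 0 ≤ μ + β) {m : ℕ}
    (h0 : ¬(m = 0 ∧ μ = -1 ∧ (α = 1 ∨ β = 1))) (h01 : ¬(m = 1 ∧ μ + α = 0 ∧ μ + β = 0)) :
    0 < turanianCoeff f α β μ m := by
  obtain ⟨C, hC, h⟩ := exists_mul_sum_le_sum_antidiagonal (c := fun k l => f k * f l)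
    (w := fun k l => ((k + l).choose k : ℝ) * symDiff α β μ k l)
    (fun k l => mul_pos (hf k) (hf l)) (fun k l => mul_comm _ _)
    (fun k l => by rw [symDiff_comm, add_comm k l, ← Nat.choose_symm_add])
    (fun k l hkl => hlc k l (by omega))
    (fun k l hkl h => by
      have hp : (0 : ℝ) < ((k + (l + 1)).choose k : ℕ) := by
        exact_mod_cast Nat.choose_pos (Nat.le_add_right _ _)
      exact mul_nonneg (Nat.cast_nonneg _)
        (symDiff_nonneg_step hμ hα hβ h1 h2 hkl (nonneg_of_mul_nonneg_right h hp))) m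
  rw [sum_choose_mul_symDiff] at h
  have hm0 : (0 : ℝ) ≤ m := m.cast_nonneg
  have hD : 0 < invGamma (α + (μ + m)) * invGamma (β + (μ + m)) -
      invGamma (α + β + (μ + m)) * invGamma (μ + m) := by
    refine sub_pos.2 (invGamma_mul_lt (by linarith) hα hβ (by linarith) (by linarith) ?_)
    rintro ⟨e, e'⟩
    have hm : (m : ℝ) = 0 := by linarith
    exact h0 ⟨by exact_mod_cast hm, by linarith, e'⟩
  have hR : 0 < rising (2 * μ + α + β + m - 1) m := by
    rcases m with _ | _ | m
    · simp [rising_zero]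
    · refine rising_pos ?_ _
      push_cast
      rcases h1.eq_or_lt with h3 | h3
      · rcases h2.eq_or_lt with h4 | h4
        · exact absurd ⟨rfl, h3.symm, h4.symm⟩ h01
        · linarith
      · linarith
    · refine rising_pos ?_ _
      push_cast
      have : (0 : ℝ) ≤ m := m.cast_nonneg
      linarith
  have hpos := (mul_pos hC (mul_pos two_pos (mul_pos hR hD))).trans_le h
  have := two_mul_turanianCoeff f α β μ m
  have h3 : 0 < (m.factorial : ℝ)⁻¹ := by positivity
  have := mul_pos h3 hpos
  linarith

theorem turanianCoeff_zero_eq_zero (h1 : μ = -1) (h : α = 1 ∨ β = 1) :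
    turanianCoeff f α β μ 0 = 0 := by
  subst h1
  rw [turanianCoeff_zero, invGamma_neg_one]
  rcases h with rfl | rfl <;> simp [invGamma_zero]

theorem turanianCoeff_one_eq_zero (h1 : μ + α = 0) (h2 : μ + β = 0) :
    turanianCoeff f α β μ 1 = 0 := by
  obtain rfl : α = -μ := by linarith
  obtain rfl : β = -μ := by linarith
  have h := sum_choose_mul_symDiff (-μ) (-μ) μ 1
  have h' := two_mul_turanianCoeff f (-μ) (-μ) μ 1
  rw [show 2 * μ + -μ + -μ + (1 : ℕ) - 1 = (0 : ℝ) by push_cast; ring] at h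
  simp only [Finset.Nat.antidiagonal_succ, rising_succ, rising_zero] at h h'
  simp at h h'
  rw [mul_comm (f 1), ← mul_add] at h'
  rw [h, mul_zero] at h'
  linarith

theorem turanianCoeff_eq_zero_iff (hf : ∀ n, 0 < f n)
    (hlc : ∀ k l, k ≤ l → f k * f (l + 1) ≤ f (k + 1) * f l) (hμ : -1 ≤ μ) (hα : 0 < α)
    (hβ : 0 < β) (h1 : 0 ≤ μ + α) (h2 : 0 ≤ μ + β) (m : ℕ) : turanianCoeff f α β μ m = 0 ↔
      (m = 0 ∧ μ = -1 ∧ (α = 1 ∨ β = 1)) ∨ (m = 1 ∧ μ + α = 0 ∧ μ + β = 0) := by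
  constructor
  · intro h
    by_contra! hne
    refine (turanianCoeff_pos hf hlc hμ hα hβ h1 h2 ?_ ?_).ne' h
    · rintro ⟨a, b, c | c⟩
      · exact (hne.1 a b).1 c
      · exact (hne.1 a b).2 c
    · exact fun h => hne.2 h.1 h.2.1 h.2.2
  · rintro (⟨rfl, h, h'⟩ | ⟨rfl, h, h'⟩)
    · exact turanianCoeff_zero_eq_zero h h'
    · exact turanianCoeff_one_eq_zero h h'

theorem turanianCoeff_nonneg (hf : ∀ n, 0 < f n)
    (hlc : ∀ k l, k ≤ l → f k * f (l + 1) ≤ f (k + 1) * f l) (hμ : -1 ≤ μ) (hα : 0 < α)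
    (hβ : 0 < β) (h1 : 0 ≤ μ + α) (h2 : 0 ≤ μ + β) (m : ℕ) : 0 ≤ turanianCoeff f α β μ m := by
  by_cases h : turanianCoeff f α β μ m = 0
  · exact h.ge
  · rw [turanianCoeff_eq_zero_iff hf hlc hμ hα hβ h1 h2, not_or] at h
    exact (turanianCoeff_pos hf hlc hμ hα hβ h1 h2 h.1 h.2).le

end Positivity

/-! ### Elementary symmetric polynomials and log-concavity of the coefficients -/

theorem elemSymm_eq_sum {q : ℕ} (x : Fin q → ℝ) (k : ℕ) :
    elemSymm x k = ∑ t ∈ Finset.powersetCard k Finset.univ, ∏ i ∈ t, x i := by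
  simp [elemSymm, MvPolynomial.esymm]

theorem elemSymm_nonneg {q : ℕ} {x : Fin q → ℝ} (hx : ∀ i, 0 < x i) (k : ℕ) :
    0 ≤ elemSymm x k := by
  rw [elemSymm_eq_sum]
  exact Finset.sum_nonneg fun t _ => Finset.prod_nonneg fun i _ => (hx i).le

theorem elemSymm_pos {q : ℕ} {x : Fin q → ℝ} (hx : ∀ i, 0 < x i) {k : ℕ} (hk : k ≤ q) :
    0 < elemSymm x k := by
  rw [elemSymm_eq_sum]
  exact Finset.sum_pos (fun t _ => Finset.prod_pos fun i _ => hx i)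
    (Finset.powersetCard_nonempty.2 (by simpa using hk))

theorem prod_add_eq_sum_elemSymm {q : ℕ} (x : Fin q → ℝ) (t : ℝ) :
    ∏ i, (x i + t) = ∑ j ∈ Finset.range (q + 1), elemSymm x j * t ^ (q - j) := by
  have h := congrArg (Polynomial.eval t)
    (Multiset.prod_X_add_C_eq_sum_esymm (Finset.univ.val.map x))
  rw [Polynomial.eval_multiset_prod, Polynomial.eval_finsetSum] at h
  simp only [Multiset.map_map, Function.comp_apply, Polynomial.eval_add, Polynomial.eval_X,
    Polynomial.eval_C, Polynomial.eval_mul, Polynomial.eval_pow, Multiset.card_map,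
    Finset.card_val, Finset.card_univ, Fintype.card_fin] at h
  have e : ∀ j, elemSymm x j = (Finset.univ.val.map x).esymm j := fun j => by
    rw [elemSymm_eq_sum, Finset.esymm_map_val]
  simp only [e]
  rw [← h]
  exact Finset.prod_congr rfl fun i _ => add_comm _ _

theorem pow_mul_pow_exchange {x y : ℝ} (hx : 0 ≤ x) (hxy : x ≤ y) {m n : ℕ} (h : m ≤ n) :
    x ^ n * y ^ m ≤ y ^ n * x ^ m := by
  obtain ⟨d, rfl⟩ := Nat.exists_eq_add_of_le h
  have := pow_le_pow_left₀ hx hxy d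
  have h2 : 0 ≤ x ^ m * y ^ m := mul_nonneg (pow_nonneg hx m) (pow_nonneg (hx.trans hxy) m)
  calc _ = x ^ m * y ^ m * x ^ d := by ring
    _ ≤ x ^ m * y ^ m * y ^ d := mul_le_mul_of_nonneg_left this h2
    _ = _ := by ring

/-- If the quotients `D k / A k` of the coefficients are monotone, so is the quotient of the
polynomials: the difference of the two sides is a sum of products of two factors with equal sign. -/
theorem sum_mul_sum_le_of_cross_le {D A : ℕ → ℝ} {n : ℕ}
    (h : ∀ k j, k ≤ j → j ≤ n → D j * A k ≤ D k * A j) {x y : ℝ} (hx : 0 ≤ x) (hxy : x ≤ y) :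
    (∑ k ∈ Finset.range (n + 1), D k * x ^ (n - k)) *
        (∑ k ∈ Finset.range (n + 1), A k * y ^ (n - k)) ≤
      (∑ k ∈ Finset.range (n + 1), D k * y ^ (n - k)) *
        (∑ k ∈ Finset.range (n + 1), A k * x ^ (n - k)) := by
  set W : ℕ → ℕ → ℝ := fun k j => y ^ (n - k) * x ^ (n - j) - x ^ (n - k) * y ^ (n - j) with hW
  have e1 : (∑ k ∈ Finset.range (n + 1), D k * y ^ (n - k)) *
        (∑ k ∈ Finset.range (n + 1), A k * x ^ (n - k)) -
      (∑ k ∈ Finset.range (n + 1), D k * x ^ (n - k)) *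
        (∑ k ∈ Finset.range (n + 1), A k * y ^ (n - k)) =
      ∑ k ∈ Finset.range (n + 1), ∑ j ∈ Finset.range (n + 1), D k * A j * W k j := by
    rw [Finset.sum_mul_sum, Finset.sum_mul_sum, ← Finset.sum_sub_distrib]
    refine Finset.sum_congr rfl fun k _ => ?_
    rw [← Finset.sum_sub_distrib]
    refine Finset.sum_congr rfl fun j _ => ?_
    rw [hW]; ring
  have e2 : ∑ k ∈ Finset.range (n + 1), ∑ j ∈ Finset.range (n + 1), D k * A j * W k j =
      ∑ k ∈ Finset.range (n + 1), ∑ j ∈ Finset.range (n + 1), -(D j * A k * W k j) := by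
    rw [Finset.sum_comm]
    refine Finset.sum_congr rfl fun k _ => Finset.sum_congr rfl fun j _ => ?_
    rw [hW]; ring
  have e3 : 0 ≤ ∑ k ∈ Finset.range (n + 1), ∑ j ∈ Finset.range (n + 1),
      (D k * A j * W k j + -(D j * A k * W k j)) := by
    refine Finset.sum_nonneg fun k hk => Finset.sum_nonneg fun j hj => ?_
    have hk := Finset.mem_range.1 hk
    have hj := Finset.mem_range.1 hj
    have : D k * A j * W k j + -(D j * A k * W k j) = (D k * A j - D j * A k) * W k j := by ring
    rw [this]
    rcases le_total k j with hkj | hkj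
    · exact mul_nonneg (sub_nonneg.2 (h k j hkj (by omega)))
        (sub_nonneg.2 (pow_mul_pow_exchange hx hxy (by omega)))
    · refine mul_nonneg_of_nonpos_of_nonpos ?_ ?_
      · linarith [h j k hkj (by omega)]
      · have := pow_mul_pow_exchange hx hxy (show n - k ≤ n - j by omega)
        rw [hW]
        simp only
        linarith
  simp only [Finset.sum_add_distrib] at e3
  linarith

theorem SymmetricChain.cross_le {p q : ℕ} {a : Fin p → ℝ} {b : Fin q → ℝ} (ha : ∀ i, 0 < a i)
    (h : SymmetricChain a b) {k j : ℕ} (hkj : k ≤ j) (hj : j ≤ p) :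
    elemSymm b (q - p + j) * elemSymm a k ≤ elemSymm b (q - p + k) * elemSymm a j := by
  have key : elemSymm b (q - p + j) / elemSymm a j ≤ elemSymm b (q - p + k) / elemSymm a k := by
    induction j, hkj using Nat.le_induction with
    | base => exact le_rfl
    | succ n _ ih => exact (h n (by omega)).trans (ih (by omega))
  rwa [div_le_div_iff₀ (elemSymm_pos ha hj) (elemSymm_pos ha (hkj.trans hj))] at key

/-- Under the chain condition `∏ (b_j + t) / ∏ (a_i + t)` is nondecreasing in `t ≥ 0`. -/
theorem SymmetricChain.prod_mul_prod_le {p q : ℕ} (hpq : p ≤ q) {a : Fin p → ℝ} {b : Fin q → ℝ}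
    (ha : ∀ i, 0 < a i) (hb : ∀ j, 0 < b j) (h : SymmetricChain a b) {x y : ℝ} (hx : 0 ≤ x)
    (hxy : x ≤ y) :
    (∏ j, (b j + x)) * ∏ i, (a i + y) ≤ (∏ j, (b j + y)) * ∏ i, (a i + x) := by
  have hsplit : ∀ t, ∏ j, (b j + t) =
      (∑ i ∈ Finset.range (q - p), elemSymm b i * t ^ (q - i)) +
        ∑ k ∈ Finset.range (p + 1), elemSymm b (q - p + k) * t ^ (p - k) := by
    intro t
    rw [prod_add_eq_sum_elemSymm, show q + 1 = q - p + (p + 1) by omega, Finset.sum_range_add]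
    congr 1
    exact Finset.sum_congr rfl fun k _ => by rw [show q - (q - p + k) = p - k by omega]
  rw [hsplit, hsplit, prod_add_eq_sum_elemSymm, prod_add_eq_sum_elemSymm, add_mul, add_mul]
  refine add_le_add ?_ (sum_mul_sum_le_of_cross_le
    (D := fun k => elemSymm b (q - p + k)) (fun k j hkj hj => h.cross_le ha hkj hj) hx hxy)
  rw [Finset.sum_mul_sum, Finset.sum_mul_sum]
  refine Finset.sum_le_sum fun i hi => Finset.sum_le_sum fun j hj => ?_
  have hi := Finset.mem_range.1 hi
  have := pow_mul_pow_exchange hx hxy (show p - j ≤ q - i by omega)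
  calc _ = elemSymm b i * elemSymm a j * (x ^ (q - i) * y ^ (p - j)) := by ring
    _ ≤ elemSymm b i * elemSymm a j * (y ^ (q - i) * x ^ (p - j)) :=
        mul_le_mul_of_nonneg_left this (mul_nonneg (elemSymm_nonneg hb i) (elemSymm_nonneg ha j))
    _ = _ := by ring

/-- The quotient `(a)_n / (b)_n` of products of rising factorials. -/
noncomputable def risingQuot {p q : ℕ} (a : Fin p → ℝ) (b : Fin q → ℝ) (n : ℕ) : ℝ :=
  (∏ i, rising (a i) n) / ∏ j, rising (b j) n

section RisingQuot

variable {p q : ℕ} {a : Fin p → ℝ} {b : Fin q → ℝ}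

theorem risingQuot_zero : risingQuot a b 0 = 1 := by simp [risingQuot, rising_zero]

theorem risingQuot_pos (ha : ∀ i, 0 < a i) (hb : ∀ j, 0 < b j) (n : ℕ) : 0 < risingQuot a b n :=
  div_pos (Finset.prod_pos fun i _ => rising_pos (ha i) n)
    (Finset.prod_pos fun j _ => rising_pos (hb j) n)

theorem risingQuot_succ (n : ℕ) : risingQuot a b (n + 1) =
    risingQuot a b n * ((∏ i, (a i + n)) / ∏ j, (b j + n)) := by
  simp only [risingQuot, rising_succ, Finset.prod_mul_distrib, div_mul_div_comm]

theorem risingQuot_logConcave (hpq : p ≤ q) (ha : ∀ i, 0 < a i) (hb : ∀ j, 0 < b j)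
    (h : SymmetricChain a b) {k l : ℕ} (hkl : k ≤ l) :
    risingQuot a b k * risingQuot a b (l + 1) ≤ risingQuot a b (k + 1) * risingQuot a b l := by
  have hB : ∀ n : ℕ, 0 < ∏ j, (b j + n) := fun n => Finset.prod_pos fun j _ => by
    have := hb j; positivity
  have key : (∏ i, (a i + (l : ℝ))) / ∏ j, (b j + (l : ℝ)) ≤
      (∏ i, (a i + (k : ℝ))) / ∏ j, (b j + (k : ℝ)) := by
    rw [div_le_div_iff₀ (hB l) (hB k), mul_comm, mul_comm (∏ i, (a i + (k : ℝ)))]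
    exact h.prod_mul_prod_le hpq ha hb k.cast_nonneg (by exact_mod_cast hkl)
  rw [risingQuot_succ, risingQuot_succ]
  have := mul_le_mul_of_nonneg_left key
    (mul_pos (risingQuot_pos ha hb k) (risingQuot_pos ha hb l)).le
  linarith

end RisingQuot

/-! ### The series of `f(ν, x)` and its Turánian -/

/-- The coefficients of the power series of `f(ν, ·)`. -/
noncomputable def regCoeff (f : ℕ → ℝ) (ν : ℝ) (n : ℕ) : ℝ :=
  f n / (n.factorial : ℝ) * invGamma (ν + n)

/-- The coefficients of the power series of `Γ(ν) f(ν, ·)`. -/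
noncomputable def normCoeff (f : ℕ → ℝ) (ν : ℝ) (n : ℕ) : ℝ :=
  f n / (n.factorial : ℝ) * (rising ν n)⁻¹

/-- The coefficients of the product of two power series. -/
def cauchyProd (c d : ℕ → ℝ) (m : ℕ) : ℝ :=
  ∑ ij ∈ Finset.HasAntidiagonal.antidiagonal m, c ij.1 * d ij.2

theorem cauchyProd_mul_pow (c d : ℕ → ℝ) (x : ℝ) (m : ℕ) : cauchyProd c d m * x ^ m =
    ∑ ij ∈ Finset.HasAntidiagonal.antidiagonal m, (c ij.1 * x ^ ij.1) * (d ij.2 * x ^ ij.2) := by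
  rw [cauchyProd, Finset.sum_mul]
  refine Finset.sum_congr rfl fun ij hij => ?_
  rw [← Finset.HasAntidiagonal.mem_antidiagonal.1 hij]
  ring

theorem EntireCoeff.cauchyProd {c d : ℕ → ℝ} (hc : EntireCoeff c) (hd : EntireCoeff d) :
    EntireCoeff (cauchyProd c d) := by
  intro x
  simp only [cauchyProd_mul_pow]
  exact (summable_norm_sum_mul_antidiagonal_of_summable_norm (hc x).norm (hd x).norm).of_norm

theorem pser_mul_pser {c d : ℕ → ℝ} (hc : EntireCoeff c) (hd : EntireCoeff d) (x : ℝ) :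
    pser c x * pser d x = pser (cauchyProd c d) x := by
  rw [pser, pser, pser,
    tsum_mul_tsum_eq_tsum_sum_antidiagonal_of_summable_norm (hc x).norm (hd x).norm]
  simp only [cauchyProd_mul_pow]

theorem EntireCoeff.sub {c d : ℕ → ℝ} (hc : EntireCoeff c) (hd : EntireCoeff d) :
    EntireCoeff fun m => c m - d m := fun x => by
  simpa only [sub_mul] using (hc x).sub (hd x)

theorem pser_sub {c d : ℕ → ℝ} (hc : EntireCoeff c) (hd : EntireCoeff d) (x : ℝ) :
    pser (fun m => c m - d m) x = pser c x - pser d x := by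
  simp only [pser, sub_mul, (hc x).tsum_sub (hd x)]

section Series

variable {f : ℕ → ℝ}

theorem entireCoeff_regCoeff (hf : ∀ n, 0 < f n)
    (hlc : ∀ k l, k ≤ l → f k * f (l + 1) ≤ f (k + 1) * f l) (ν : ℝ) :
    EntireCoeff (regCoeff f ν) := by
  intro x
  set R := f 1 / f 0 with hR
  have hR0 : 0 < R := div_pos (hf 1) (hf 0)
  have hfR : ∀ n, f (n + 1) ≤ R * f n := fun n => by
    rw [hR, div_mul_eq_mul_div, le_div_iff₀ (hf 0), mul_comm]
    exact hlc 0 n (Nat.zero_le n)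
  obtain ⟨N, hN⟩ := exists_nat_ge (max (1 - ν) (2 * (R * |x|)))
  refine summable_of_ratio_norm_eventually_le (r := 1 / 2) (by norm_num)
    (Filter.eventually_atTop.2 ⟨N, fun n hn => ?_⟩)
  have hn' : (N : ℝ) ≤ n := by exact_mod_cast hn
  have h1 : 1 ≤ ν + n := by linarith [le_max_left (1 - ν) (2 * (R * |x|))]
  have h2 : 2 * (R * |x|) ≤ n := by linarith [le_max_right (1 - ν) (2 * (R * |x|))]
  have g0 : 0 ≤ invGamma (ν + n + 1) := invGamma_nonneg (by linarith)
  have h3 : invGamma (ν + n + 1) ≤ invGamma (ν + n) := by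
    rw [invGamma_eq_mul (ν + n)]
    exact le_mul_of_one_le_left g0 h1
  have e : (n + 1 : ℕ) = (n : ℝ) + 1 := by push_cast; ring
  have hfn := hf n
  have hfn1 := hf (n + 1)
  have hn1 : (0 : ℝ) < n + 1 := by positivity
  simp only [regCoeff, norm_mul, norm_pow, norm_div, Real.norm_eq_abs, e, ← add_assoc,
    abs_of_pos hn1, abs_of_pos hfn, abs_of_pos hfn1, abs_of_nonneg g0, abs_of_nonneg (g0.trans h3),
    Nat.abs_cast, Nat.factorial_succ, Nat.cast_mul]
  calc f (n + 1) / ((n + 1) * n.factorial) * invGamma (ν + n + 1) * |x| ^ (n + 1)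
      ≤ R * f n / ((n + 1) * n.factorial) * invGamma (ν + n) * |x| ^ (n + 1) := by
        gcongr
        exact hfR n
    _ = (R * |x| / (n + 1)) * (f n / n.factorial * invGamma (ν + n) * |x| ^ n) := by
        rw [pow_succ]
        field_simp
    _ ≤ 1 / 2 * (f n / n.factorial * invGamma (ν + n) * |x| ^ n) := by
        have : 0 ≤ invGamma (ν + n) := g0.trans h3
        gcongr ?_ * _
        rw [div_le_div_iff₀ hn1 two_pos]
        linarith

theorem invGamma_eq_rising_mul (ν : ℝ) (n : ℕ) : invGamma ν = rising ν n * invGamma (ν + n) := by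
  induction n with
  | zero => simp [rising_zero]
  | succ n ih =>
    rw [ih, rising_succ, invGamma_eq_mul (ν + n)]
    push_cast
    rw [add_assoc ν]
    ring

theorem rising_ne_zero {ν : ℝ} (hν : ∀ n : ℕ, ν ≠ -(n : ℝ)) (n : ℕ) : rising ν n ≠ 0 := by
  induction n with
  | zero => simp [rising_zero]
  | succ n ih =>
    rw [rising_succ]
    exact mul_ne_zero ih fun h => hν n (by linarith)

theorem regCoeff_eq_invGamma_mul {ν : ℝ} (hν : ∀ n : ℕ, ν ≠ -(n : ℝ)) (n : ℕ) :
    regCoeff f ν n = invGamma ν * normCoeff f ν n := by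
  have := rising_ne_zero hν n
  rw [regCoeff, normCoeff, invGamma_eq_rising_mul ν n]
  field_simp

theorem normCoeff_eq {ν : ℝ} (hν : ∀ n : ℕ, ν ≠ -(n : ℝ)) (n : ℕ) :
    normCoeff f ν n = Real.Gamma ν * regCoeff f ν n := by
  rw [regCoeff_eq_invGamma_mul hν, invGamma, mul_inv_cancel_left₀ (Real.Gamma_ne_zero hν)]

theorem entireCoeff_normCoeff (hf : ∀ n, 0 < f n)
    (hlc : ∀ k l, k ≤ l → f k * f (l + 1) ≤ f (k + 1) * f l) {ν : ℝ}
    (hν : ∀ n : ℕ, ν ≠ -(n : ℝ)) : EntireCoeff (normCoeff f ν) := fun x => by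
  simpa only [normCoeff_eq hν, mul_assoc] using
    (entireCoeff_regCoeff hf hlc ν x).mul_left (Real.Gamma ν)

theorem pser_regCoeff {ν : ℝ} (hν : ∀ n : ℕ, ν ≠ -(n : ℝ)) (x : ℝ) :
    pser (regCoeff f ν) x = invGamma ν * pser (normCoeff f ν) x := by
  simp only [pser, regCoeff_eq_invGamma_mul hν, mul_assoc, tsum_mul_left]

theorem ne_neg_natCast_of_pos {ν : ℝ} (hν : 0 < ν) (n : ℕ) : ν ≠ -(n : ℝ) := by
  have : (0 : ℝ) ≤ n := n.cast_nonneg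
  linarith

theorem turanian_pser (hf : ∀ n, 0 < f n)
    (hlc : ∀ k l, k ≤ l → f k * f (l + 1) ≤ f (k + 1) * f l) (α β μ : ℝ) :
    EntireCoeff (turanianCoeff f α β μ) ∧
      turanian (fun ν => pser (regCoeff f ν)) α β μ = pser (turanianCoeff f α β μ) := by
  have e := entireCoeff_regCoeff hf hlc
  have h : turanianCoeff f α β μ = fun m => cauchyProd (regCoeff f (α + μ)) (regCoeff f (β + μ)) m -
      cauchyProd (regCoeff f (α + β + μ)) (regCoeff f μ) m := by
    funext m
    rw [turanianCoeff, cauchyProd, cauchyProd, ← Finset.sum_sub_distrib]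
    refine Finset.sum_congr rfl fun ij _ => ?_
    simp only [regCoeff]
    ring
  rw [h]
  refine ⟨((e _).cauchyProd (e _)).sub ((e _).cauchyProd (e _)), funext fun x => ?_⟩
  rw [pser_sub ((e _).cauchyProd (e _)) ((e _).cauchyProd (e _)), ← pser_mul_pser (e _) (e _),
    ← pser_mul_pser (e _) (e _), turanian]

end Series

/-! ### Positivity and continuity in the parameter -/

theorem rising_mono {c d : ℝ} (hc : 0 < c) (hcd : c ≤ d) (n : ℕ) : rising c n ≤ rising d n := by
  induction n with
  | zero => simp [rising_zero]
  | succ n ih =>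
    rw [rising_succ, rising_succ]
    have := rising_pos hc n
    have := rising_pos (hc.trans_le hcd) n
    gcongr

theorem rising_add (c : ℝ) (m n : ℕ) : rising c (m + n) = rising c m * rising (c + m) n := by
  induction n with
  | zero => simp [rising_zero]
  | succ n ih =>
    rw [← add_assoc, rising_succ, rising_succ, ih]
    push_cast
    ring

theorem rising_mul_rising_le {c α β : ℝ} (hc : 0 < c) (hα : 0 < α) (hβ : 0 < β) (n : ℕ) :
    rising c n * rising (α + β + c) n ≤ rising (α + c) n * rising (β + c) n := by
  induction n with
  | zero => simp [rising_zero]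
  | succ n ih =>
    simp only [rising_succ]
    have h1 := rising_pos hc n
    have h2 := rising_pos (show 0 < α + β + c by positivity) n
    have h : (c + n) * (α + β + c + n) ≤ (α + c + n) * (β + c + n) := by
      nlinarith [mul_pos hα hβ]
    calc _ = (rising c n * rising (α + β + c) n) * ((c + n) * (α + β + c + n)) := by ring
      _ ≤ (rising (α + c) n * rising (β + c) n) * ((α + c + n) * (β + c + n)) :=
          mul_le_mul ih h (by positivity) ((mul_pos h1 h2).le.trans ih)
      _ = _ := by ring

section Series

variable {f : ℕ → ℝ}

theorem normCoeff_pos (hf : ∀ n, 0 < f n) {ν : ℝ} (hν : 0 < ν) (n : ℕ) : 0 < normCoeff f ν n := by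
  have := hf n
  have := rising_pos hν n
  unfold normCoeff
  positivity

theorem normCoeff_anti (hf : ∀ n, 0 < f n) {ν ν' : ℝ} (hν : 0 < ν) (h : ν ≤ ν') (n : ℕ) :
    normCoeff f ν' n ≤ normCoeff f ν n := by
  have := hf n
  have := rising_pos hν n
  have := rising_mono hν h n
  unfold normCoeff
  gcongr

theorem normCoeff_zero (ν : ℝ) : normCoeff f ν 0 = f 0 := by simp [normCoeff, rising_zero]

theorem regCoeff_nonneg (hf : ∀ n, 0 < f n) {ν : ℝ} (hν : 0 ≤ ν) (n : ℕ) : 0 ≤ regCoeff f ν n :=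
  mul_nonneg (div_nonneg (hf n).le (Nat.cast_nonneg _)) (invGamma_nonneg (by positivity))

theorem regCoeff_pos (hf : ∀ n, 0 < f n) {ν : ℝ} {n : ℕ} (h : 0 < ν + n) : 0 < regCoeff f ν n := by
  have := hf n
  have := invGamma_pos h
  unfold regCoeff
  positivity

theorem pser_regCoeff_pos (hf : ∀ n, 0 < f n)
    (hlc : ∀ k l, k ≤ l → f k * f (l + 1) ≤ f (k + 1) * f l) {ν x : ℝ} (hν : 0 ≤ ν) (hx : 0 < x) :
    0 < pser (regCoeff f ν) x :=
  pser_pos (entireCoeff_regCoeff hf hlc ν) (regCoeff_nonneg hf hν)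
    (regCoeff_pos hf (n := 1) (by push_cast; linarith)) hx

theorem pser_regCoeff_pos_of_pos (hf : ∀ n, 0 < f n)
    (hlc : ∀ k l, k ≤ l → f k * f (l + 1) ≤ f (k + 1) * f l) {ν x : ℝ} (hν : 0 < ν) (hx : 0 ≤ x) :
    0 < pser (regCoeff f ν) x := by
  rcases hx.eq_or_lt with rfl | hx
  · rw [pser_zero]
    exact regCoeff_pos hf (by simpa using hν)
  · exact pser_regCoeff_pos hf hlc hν.le hx

theorem pser_regCoeff_neg_one_pos (hf : ∀ n, 0 < f n)
    (hlc : ∀ k l, k ≤ l → f k * f (l + 1) ≤ f (k + 1) * f l) {x : ℝ} (hx : 0 < x) :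
    0 < pser (regCoeff f (-1)) x := by
  refine pser_pos (k := 2) (entireCoeff_regCoeff hf hlc _) (fun n => ?_)
    (regCoeff_pos hf (by norm_num)) hx
  rcases n with _ | n
  · simp [regCoeff, invGamma_neg_one]
  · refine mul_nonneg (div_nonneg (hf _).le (Nat.cast_nonneg _)) (invGamma_nonneg ?_)
    push_cast
    linarith [(n.cast_nonneg : (0 : ℝ) ≤ n)]

theorem continuousOn_pser_regCoeff (hf : ∀ n, 0 < f n)
    (hlc : ∀ k l, k ≤ l → f k * f (l + 1) ≤ f (k + 1) * f l) (x : ℝ) :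
    ContinuousOn (fun ν => pser (regCoeff f ν) x) (Ioi 0) := by
  have hnorm : ContinuousOn (fun ν => pser (normCoeff f ν) x) (Ioi 0) := by
    intro ν hν
    have hν : 0 < ν := hν
    have h2 : 0 < ν / 2 := by positivity
    have hs := ((entireCoeff_normCoeff hf hlc (ne_neg_natCast_of_pos h2)).abs x)
    have hc : ContinuousOn (fun ν => pser (normCoeff f ν) x) (Ici (ν / 2)) := by
      refine continuousOn_tsum (fun n => ?_) hs fun n c hc => ?_
      · refine ContinuousOn.mul (ContinuousOn.mul continuousOn_const ?_) continuousOn_const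
        exact (ascPochhammer ℝ n).continuous.continuousOn.inv₀ fun c hc =>
          (rising_pos (h2.trans_le hc) n).ne'
      · rw [norm_mul, norm_pow, Real.norm_eq_abs, Real.norm_eq_abs,
          abs_of_pos (normCoeff_pos hf (h2.trans_le hc) n), abs_of_pos (normCoeff_pos hf h2 n)]
        exact mul_le_mul_of_nonneg_right (normCoeff_anti hf h2 hc n) (by positivity)
    exact (hc.continuousAt (Ici_mem_nhds (by linarith))).continuousWithinAt
  have hG : ContinuousOn invGamma (Ioi 0) := by
    intro ν hν
    have hν : 0 < ν := hν
    exact ((Real.differentiableAt_Gamma (ne_neg_natCast_of_pos hν)).continuousAt.inv₀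
      (Real.Gamma_pos_of_pos hν).ne').continuousWithinAt
  exact (hG.mul hnorm).congr fun ν hν => pser_regCoeff (ne_neg_natCast_of_pos hν) x

end Series

/-! ### Strict log-concavity and the comparison of `Γ(ν) f(ν, x)` -/

/-- A continuous function that satisfies the strict midpoint inequality is strictly concave: the
difference to a chord has no minimum inside the interval. -/
theorem strictConcaveOn_of_continuousOn {g : ℝ → ℝ} {s : Set ℝ} (hs : Convex ℝ s)
    (hg : ContinuousOn g s)
    (h : ∀ z ε, 0 < ε → z - ε ∈ s → z + ε ∈ s → g (z - ε) + g (z + ε) < 2 * g z) :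
    StrictConcaveOn ℝ s g := by
  refine LinearOrder.strictConcaveOn_of_lt hs fun x hx y hy hxy a b ha hb hab => ?_
  have hsub : Icc x y ⊆ s := hs.ordConnected.out hx hy
  set L : ℝ → ℝ := fun z => g x + (z - x) / (y - x) * (g y - g x) with hL
  have hyx : y - x ≠ 0 := (sub_pos.2 hxy).ne'
  have hcont : ContinuousOn (fun z => g z - L z) (Icc x y) := by
    refine (hg.mono hsub).sub (Continuous.continuousOn ?_)
    rw [hL]
    fun_prop
  have hno : ∀ w ∈ Ioo x y, ¬IsMinOn (fun z => g z - L z) (Icc x y) w := by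
    intro w hw hmin
    have hε : 0 < min (w - x) (y - w) := lt_min (sub_pos.2 hw.1) (sub_pos.2 hw.2)
    set ε := min (w - x) (y - w)
    have h1 : w - ε ∈ Icc x y := ⟨by linarith [min_le_left (w - x) (y - w)], by linarith [hw.2]⟩
    have h2 : w + ε ∈ Icc x y := ⟨by linarith [hw.1], by linarith [min_le_right (w - x) (y - w)]⟩
    have h3 := h w ε hε (hsub h1) (hsub h2)
    have h4 : g w - L w ≤ g (w - ε) - L (w - ε) := hmin h1
    have h5 : g w - L w ≤ g (w + ε) - L (w + ε) := hmin h2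
    have h6 : L (w - ε) + L (w + ε) = 2 * L w := by rw [hL]; ring
    linarith
  have hw : a • x + b • y ∈ Ioo x y := by
    obtain rfl : a = 1 - b := by linarith
    simp only [smul_eq_mul]
    exact ⟨by nlinarith, by nlinarith⟩
  have hLx : g x - L x = 0 := by rw [hL]; simp
  have hLy : g y - L y = 0 := by simp only [hL]; rw [div_self hyx]; ring
  have hLw : L (a • x + b • y) = a • g x + b • g y := by
    obtain rfl : a = 1 - b := by linarith
    simp only [hL, smul_eq_mul]
    field_simp
    ring
  obtain ⟨z, hz, hmin⟩ := isCompact_Icc.exists_isMinOn (nonempty_Icc.2 hxy.le) hcont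
  have hz0 : g z - L z = 0 := by
    rcases hz.1.eq_or_lt with rfl | h1
    · exact hLx
    rcases hz.2.eq_or_lt with rfl | h2
    · exact hLy
    · exact absurd hmin (hno z ⟨h1, h2⟩)
  have hge : g z - L z ≤ g (a • x + b • y) - L (a • x + b • y) := hmin (Ioo_subset_Icc_self hw)
  rw [hz0] at hge
  rw [← hLw]
  refine lt_of_le_of_ne (by linarith) fun heq => hno _ hw fun z' hz' => ?_
  have : g z - L z ≤ g z' - L z' := hmin hz'
  change g (a • x + b • y) - L (a • x + b • y) ≤ g z' - L z'
  linarith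

section Bounds

variable {f : ℕ → ℝ}

theorem strictLogConcaveOn_pser_regCoeff (hf : ∀ n, 0 < f n)
    (hlc : ∀ k l, k ≤ l → f k * f (l + 1) ≤ f (k + 1) * f l) {x : ℝ} (hx : 0 ≤ x) :
    StrictLogConcaveOn (Ioi 0) fun ν => pser (regCoeff f ν) x := by
  have hpos := fun ν (hν : ν ∈ Ioi (0 : ℝ)) => pser_regCoeff_pos_of_pos hf hlc (mem_Ioi.1 hν) hx
  refine ⟨hpos, strictConcaveOn_of_continuousOn (convex_Ioi 0)
    ((continuousOn_pser_regCoeff hf hlc x).log fun ν hν => (hpos ν hν).ne') ?_⟩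
  intro z ε hε h1 h2
  have h1' : 0 < z - ε := h1
  have hz : z ∈ Ioi (0 : ℝ) := by simp only [mem_Ioi]; linarith
  obtain ⟨he, ht⟩ := turanian_pser hf hlc ε ε (z - ε)
  have hnn := turanianCoeff_nonneg hf hlc (show -1 ≤ z - ε by linarith) hε hε (by linarith)
    (by linarith)
  have h0 : 0 < turanianCoeff f ε ε (z - ε) 0 :=
    turanianCoeff_pos hf hlc (by linarith) hε hε (by linarith) (by linarith)
      (fun h => by linarith [h.2.1]) (fun h => by simp at h)
  have hT : 0 < turanian (fun ν => pser (regCoeff f ν)) ε ε (z - ε) x := by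
    rw [ht]
    refine h0.trans_le ?_
    rw [← pser_zero (turanianCoeff f ε ε (z - ε))]
    exact pser_mono he hnn le_rfl hx
  rw [turanian, show ε + (z - ε) = z by ring, show ε + ε + (z - ε) = z + ε by ring, sub_pos] at hT
  have p1 := hpos _ h1
  have p2 := hpos _ h2
  have p3 := hpos _ hz
  have := Real.log_lt_log (mul_pos p2 p1) hT
  rw [Real.log_mul p2.ne' p1.ne', Real.log_mul p3.ne' p3.ne'] at this
  linarith

/-- If `p q ≤ u v` and `u` exceeds both `p` and `q`, then `p + q ≤ u + v`, because
`(u - p) (u - q) ≥ 0`. -/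
theorem add_le_add_of_mul_le_mul {p q u v : ℝ} (hu : 0 < u) (hpu : p ≤ u) (hqu : q ≤ u)
    (h : p * q ≤ u * v) : p + q ≤ u + v := by
  have := mul_nonneg (sub_nonneg.2 hpu) (sub_nonneg.2 hqu)
  refine le_of_mul_le_mul_left ?_ hu
  linarith

theorem inv_rising_sum_le {μ α β : ℝ} (hμ : 0 < μ) (hα : 0 < α) (hβ : 0 < β) (i j : ℕ) :
    (rising (α + μ) i)⁻¹ * (rising (β + μ) j)⁻¹ + (rising (α + μ) j)⁻¹ * (rising (β + μ) i)⁻¹ ≤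
      (rising μ i)⁻¹ * (rising (α + β + μ) j)⁻¹ + (rising μ j)⁻¹ * (rising (α + β + μ) i)⁻¹ := by
  wlog hij : i ≤ j generalizing i j
  · have := this j i (by omega)
    linarith
  obtain ⟨n, rfl⟩ := Nat.exists_eq_add_of_le hij
  have hprod : ∀ {c : ℝ}, 0 < c → ∀ n, (rising (α + c) n)⁻¹ * (rising (β + c) n)⁻¹ ≤
      (rising c n)⁻¹ * (rising (α + β + c) n)⁻¹ := by
    intro c hc n
    rw [← mul_inv, ← mul_inv]
    exact inv_anti₀ (mul_pos (rising_pos hc n) (rising_pos (by positivity) n))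
      (rising_mul_rising_le hc hα hβ n)
  have hc : 0 < μ + i := by positivity
  have h1 := hprod hμ i
  have h2 := hprod hc n
  have p0 : 0 < (rising (μ + i) n)⁻¹ := inv_pos.2 (rising_pos hc n)
  have h3 := add_le_add_of_mul_le_mul p0
    (inv_anti₀ (rising_pos hc n) (rising_mono hc (show μ + i ≤ α + (μ + i) by linarith) n))
    (inv_anti₀ (rising_pos hc n) (rising_mono hc (show μ + i ≤ β + (μ + i) by linarith) n)) h2
  have q1 : 0 ≤ (rising (α + (μ + i)) n)⁻¹ := (inv_pos.2 (rising_pos (by positivity) n)).le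
  have q2 : 0 ≤ (rising (β + (μ + i)) n)⁻¹ := (inv_pos.2 (rising_pos (by positivity) n)).le
  have q3 : 0 ≤ (rising μ i)⁻¹ * (rising (α + β + μ) i)⁻¹ :=
    mul_nonneg (inv_pos.2 (rising_pos hμ i)).le (inv_pos.2 (rising_pos (by positivity) i)).le
  have h4 := mul_le_mul h1 h3 (add_nonneg q1 q2) q3
  simp only [rising_add, mul_inv, add_assoc] at h4 ⊢
  linarith

/-- The left inequality in terms of `Γ(ν) f(ν, x)` for `μ > 0`: all coefficients of the
difference are nonnegative. -/
theorem pser_normCoeff_mul_lt_of_pos (hf : ∀ n, 0 < f n)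
    (hlc : ∀ k l, k ≤ l → f k * f (l + 1) ≤ f (k + 1) * f l) {μ α β x : ℝ} (hμ : 0 < μ)
    (hα : 0 < α) (hβ : 0 < β) (hx : 0 < x) :
    pser (normCoeff f (α + μ)) x * pser (normCoeff f (β + μ)) x <
      pser (normCoeff f μ) x * pser (normCoeff f (α + β + μ)) x := by
  have e : ∀ {ν : ℝ}, 0 < ν → EntireCoeff (normCoeff f ν) := fun h =>
    entireCoeff_normCoeff hf hlc (ne_neg_natCast_of_pos h)
  have e1 := e (show 0 < α + μ by positivity)
  have e2 := e (show 0 < β + μ by positivity)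
  have e3 := e (show 0 < α + β + μ by positivity)
  rw [pser_mul_pser e1 e2, pser_mul_pser (e hμ) e3, ← sub_pos,
    ← pser_sub ((e hμ).cauchyProd e3) (e1.cauchyProd e2)]
  refine pser_pos (k := 1) (((e hμ).cauchyProd e3).sub (e1.cauchyProd e2)) (fun m => ?_) ?_ hx
  · have hsum : 2 * (cauchyProd (normCoeff f μ) (normCoeff f (α + β + μ)) m -
        cauchyProd (normCoeff f (α + μ)) (normCoeff f (β + μ)) m) =
        ∑ ij ∈ Finset.HasAntidiagonal.antidiagonal m,
          f ij.1 / (ij.1.factorial : ℝ) * (f ij.2 / (ij.2.factorial : ℝ)) *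
          ((rising μ ij.1)⁻¹ * (rising (α + β + μ) ij.2)⁻¹ +
            (rising μ ij.2)⁻¹ * (rising (α + β + μ) ij.1)⁻¹ -
            ((rising (α + μ) ij.1)⁻¹ * (rising (β + μ) ij.2)⁻¹ +
              (rising (α + μ) ij.2)⁻¹ * (rising (β + μ) ij.1)⁻¹)) := by
      simp only [cauchyProd]
      rw [← Finset.sum_sub_distrib, two_mul]
      nth_rewrite 2 [← Finset.Nat.sum_antidiagonal_swap]
      rw [← Finset.sum_add_distrib]
      refine Finset.sum_congr rfl fun ij _ => ?_
      simp only [Prod.fst_swap, Prod.snd_swap, normCoeff]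
      ring
    have : 0 ≤ 2 * (cauchyProd (normCoeff f μ) (normCoeff f (α + β + μ)) m -
        cauchyProd (normCoeff f (α + μ)) (normCoeff f (β + μ)) m) := by
      rw [hsum]
      refine Finset.sum_nonneg fun ij _ => mul_nonneg (mul_nonneg ?_ ?_)
        (sub_nonneg.2 (inv_rising_sum_le hμ hα hβ _ _))
      · exact div_nonneg (hf _).le (Nat.cast_nonneg _)
      · exact div_nonneg (hf _).le (Nat.cast_nonneg _)
    linarith
  · have h1 : cauchyProd (normCoeff f μ) (normCoeff f (α + β + μ)) 1 -
        cauchyProd (normCoeff f (α + μ)) (normCoeff f (β + μ)) 1 =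
        f 0 * f 1 * ((μ⁻¹ - (α + μ)⁻¹) - ((β + μ)⁻¹ - (α + β + μ)⁻¹)) := by
      simp [cauchyProd, Finset.Nat.antidiagonal_succ, normCoeff, rising_succ, rising_zero]
      ring
    rw [h1]
    refine mul_pos (mul_pos (hf 0) (hf 1)) (sub_pos.2 ?_)
    rw [inv_sub_inv (by positivity) (by positivity), inv_sub_inv (by positivity) (by positivity),
      show α + β + μ - (β + μ) = α by ring, show α + μ - μ = α by ring]
    have : μ * (α + μ) < (β + μ) * (α + β + μ) := by nlinarith [mul_pos hα hβ, mul_pos hβ hμ]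
    gcongr

theorem pser_normCoeff_mul_lt_of_neg (hf : ∀ n, 0 < f n)
    (hlc : ∀ k l, k ≤ l → f k * f (l + 1) ≤ f (k + 1) * f l) (hf0 : f 0 = 1) {μ α β x : ℝ}
    (hμ : -1 < μ) (hμ0 : μ < 0) (hα : 0 < α + μ) (hβ : 0 < β + μ) (hx : 0 < x) :
    pser (normCoeff f μ) x * pser (normCoeff f (α + β + μ)) x <
      pser (normCoeff f (α + μ)) x * pser (normCoeff f (β + μ)) x := by
  have e : ∀ {ν : ℝ}, 0 < ν → EntireCoeff (normCoeff f ν) := fun h =>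
    entireCoeff_normCoeff hf hlc (ne_neg_natCast_of_pos h)
  have hM : 0 < α + β + μ := by linarith
  have hne : ∀ n : ℕ, μ ≠ -(n : ℝ) := by
    rintro (_ | n) h
    · simp at h; linarith
    · push_cast at h
      linarith [(n.cast_nonneg : (0 : ℝ) ≤ n)]
  have hneg : ∀ n, rising μ (n + 1) ≤ 0 := by
    intro n
    rw [add_comm, rising_add]
    refine mul_nonpos_of_nonpos_of_nonneg ?_ (rising_pos (by push_cast; linarith) n).le
    simp [rising]
    exact hμ0.le
  have h1 : pser (normCoeff f μ) x ≤ 1 := by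
    rw [pser, (entireCoeff_normCoeff hf hlc hne x).tsum_eq_zero_add]
    have : ∑' n, normCoeff f μ (n + 1) * x ^ (n + 1) ≤ 0 := by
      refine tsum_nonpos fun n => mul_nonpos_of_nonpos_of_nonneg
        (mul_nonpos_of_nonneg_of_nonpos (div_nonneg (hf _).le (Nat.cast_nonneg _))
          (inv_nonpos.2 (hneg n))) (by positivity)
    simp only [normCoeff_zero, hf0, pow_zero, mul_one]
    linarith
  have h2 : 1 < pser (normCoeff f (β + μ)) x := by
    have := coeff_zero_lt_pser (e hβ) (fun n => (normCoeff_pos hf hβ n).le) one_ne_zero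
      (normCoeff_pos hf hβ 1) hx
    rwa [normCoeff_zero, hf0] at this
  have h3 : 0 < pser (normCoeff f (α + β + μ)) x :=
    pser_pos (e hM) (fun n => (normCoeff_pos hf hM n).le) (normCoeff_pos hf hM 0) hx
  have h4 : pser (normCoeff f (α + β + μ)) x ≤ pser (normCoeff f (α + μ)) x :=
    (e hM x).tsum_le_tsum (fun n => mul_le_mul_of_nonneg_right
      (normCoeff_anti hf hα (by linarith) n) (by positivity)) (e hα x)
  have h5 := mul_le_mul_of_nonneg_right h1 h3.le
  have h6 := mul_lt_mul_of_pos_left h2 (h3.trans_le h4)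
  linarith

end Bounds

/-! ### The two-sided bound with the conventions at the poles -/

theorem extGamma_of_ne {z : ℝ} (h0 : z ≠ 0) (h1 : z ≠ -1) :
    extGamma z = ((Real.Gamma z : ℝ) : EReal) := by
  simp [extGamma, h0, h1]

theorem extGamma_zero : extGamma 0 = ⊤ := by simp [extGamma]

theorem extGamma_neg_one : extGamma (-1) = ⊥ := by simp [extGamma]

theorem extGamma_of_pos {z : ℝ} (h : 0 < z) : extGamma z = ((Real.Gamma z : ℝ) : EReal) :=
  extGamma_of_ne h.ne' (by linarith)

theorem coe_Gamma_pos {z : ℝ} (h : 0 < z) : (0 : EReal) < ((Real.Gamma z : ℝ) : EReal) :=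
  EReal.coe_pos.2 (Real.Gamma_pos_of_pos h)

theorem extGamma_pos {z : ℝ} (h : 0 ≤ z) : 0 < extGamma z := by
  rcases h.eq_or_lt with rfl | h
  · rw [extGamma_zero]; exact EReal.zero_lt_top
  · rw [extGamma_of_pos h]; exact coe_Gamma_pos h

theorem extGamma_div_eq_zero {μ M : ℝ} (hM : 0 < M) (hμ : μ = -1 ∨ μ = 0) (N : EReal) :
    N / (extGamma μ * extGamma M) = 0 := by
  rw [extGamma_of_pos hM]
  rcases hμ with rfl | rfl
  · rw [extGamma_neg_one, EReal.bot_mul_of_pos (coe_Gamma_pos hM), EReal.div_bot]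
  · rw [extGamma_zero, EReal.top_mul_of_pos (coe_Gamma_pos hM), EReal.div_top]

theorem extGamma_quot_eq_coe {A B μ M : ℝ} (hA : 0 < A) (hB : 0 < B) (hM : 0 < M) (h0 : μ ≠ 0)
    (h1 : μ ≠ -1) : extGamma A * extGamma B / (extGamma μ * extGamma M) =
      ((Real.Gamma A * Real.Gamma B / (Real.Gamma μ * Real.Gamma M) : ℝ) : EReal) := by
  rw [extGamma_of_pos hA, extGamma_of_pos hB, extGamma_of_pos hM, extGamma_of_ne h0 h1,
    EReal.coe_div, EReal.coe_mul, EReal.coe_mul]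

theorem extGamma_quot_eq_bot {A B μ M : ℝ} (hA : 0 ≤ A) (hB : 0 ≤ B) (hAB : A = 0 ∨ B = 0)
    (hM : 0 < M) (hμ : -1 < μ) (hμ0 : μ < 0) :
    extGamma A * extGamma B / (extGamma μ * extGamma M) = ⊥ := by
  have hN : extGamma A * extGamma B = ⊤ := by
    rcases hAB with rfl | rfl
    · rw [extGamma_zero, EReal.top_mul_of_pos (extGamma_pos hB)]
    · rw [extGamma_zero, EReal.mul_top_of_pos (extGamma_pos hA)]
  have hG : Real.Gamma μ < 0 := inv_lt_zero.1 (invGamma_neg_of_mem hμ hμ0)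
  rw [hN, extGamma_of_pos hM, extGamma_of_ne hμ0.ne hμ.ne', ← EReal.coe_mul]
  refine EReal.top_div_of_neg_ne_bot ?_ (EReal.coe_ne_bot _)
  exact EReal.coe_neg'.2 (mul_neg_of_neg_of_pos hG (Real.Gamma_pos_of_pos hM))

section Ratio

variable {f : ℕ → ℝ} {μ α β : ℝ}

theorem gammaQuot_lt_regQuot (hf : ∀ n, 0 < f n)
    (hlc : ∀ k l, k ≤ l → f k * f (l + 1) ≤ f (k + 1) * f l) (hf0 : f 0 = 1) (hμ : -1 < μ)
    (hμ0 : μ ≠ 0) (hα : 0 < α) (hβ : 0 < β) (h1 : 0 < α + μ) (h2 : 0 < β + μ) {x : ℝ}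
    (hx : 0 < x) :
    Real.Gamma (α + μ) * Real.Gamma (β + μ) / (Real.Gamma μ * Real.Gamma (α + β + μ)) <
      pser (regCoeff f μ) x * pser (regCoeff f (α + β + μ)) x /
        (pser (regCoeff f (α + μ)) x * pser (regCoeff f (β + μ)) x) := by
  have hM : 0 < α + β + μ := by linarith
  have hne : ∀ n : ℕ, μ ≠ -(n : ℝ) := by
    rintro (_ | n) h
    · simp at h; exact hμ0 h
    · push_cast at h
      linarith [(n.cast_nonneg : (0 : ℝ) ≤ n)]
  have hpos : ∀ {ν : ℝ}, 0 < ν → 0 < pser (normCoeff f ν) x := fun h =>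
    pser_pos (entireCoeff_normCoeff hf hlc (ne_neg_natCast_of_pos h))
      (fun n => (normCoeff_pos hf h n).le) (normCoeff_pos hf h 0) hx
  have p1 := hpos h1
  have p2 := hpos h2
  have g1 := Real.Gamma_pos_of_pos h1
  have g2 := Real.Gamma_pos_of_pos h2
  have gM := Real.Gamma_pos_of_pos hM
  have gμ : Real.Gamma μ ≠ 0 := Real.Gamma_ne_zero hne
  set K := Real.Gamma (α + μ) * Real.Gamma (β + μ) / (Real.Gamma μ * Real.Gamma (α + β + μ))
    with hK
  set Q := pser (normCoeff f μ) x * pser (normCoeff f (α + β + μ)) x /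
    (pser (normCoeff f (α + μ)) x * pser (normCoeff f (β + μ)) x) with hQ
  have hKQ : pser (regCoeff f μ) x * pser (regCoeff f (α + β + μ)) x /
      (pser (regCoeff f (α + μ)) x * pser (regCoeff f (β + μ)) x) = K * Q := by
    rw [pser_regCoeff hne, pser_regCoeff (ne_neg_natCast_of_pos h1),
      pser_regCoeff (ne_neg_natCast_of_pos h2), pser_regCoeff (ne_neg_natCast_of_pos hM), hK, hQ]
    simp only [invGamma]
    field_simp
  rw [hKQ]
  rcases hμ0.lt_or_gt with hneg | hpos
  · have gneg : Real.Gamma μ < 0 := inv_lt_zero.1 (invGamma_neg_of_mem hμ hneg)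
    have hK0 : K < 0 := div_neg_of_pos_of_neg (mul_pos g1 g2) (mul_neg_of_neg_of_pos gneg gM)
    have hQ1 : Q < 1 := (div_lt_one (mul_pos p1 p2)).2
      (pser_normCoeff_mul_lt_of_neg hf hlc hf0 hμ hneg h1 h2 hx)
    nlinarith
  · have hK0 : 0 < K := div_pos (mul_pos g1 g2) (mul_pos (Real.Gamma_pos_of_pos hpos) gM)
    have hQ1 : 1 < Q := (one_lt_div (mul_pos p1 p2)).2
      (pser_normCoeff_mul_lt_of_pos hf hlc hpos hα hβ hx)
    nlinarith

theorem extGamma_quot_lt_regQuot (hf : ∀ n, 0 < f n)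
    (hlc : ∀ k l, k ≤ l → f k * f (l + 1) ≤ f (k + 1) * f l) (hf0 : f 0 = 1) (hμ : -1 ≤ μ)
    (hα : 0 < α) (hβ : 0 < β) (h1 : 0 ≤ α + μ) (h2 : 0 ≤ β + μ) {x : ℝ} (hx : 0 < x) :
    extGamma (α + μ) * extGamma (β + μ) / (extGamma μ * extGamma (α + β + μ)) <
      ((pser (regCoeff f μ) x * pser (regCoeff f (α + β + μ)) x /
        (pser (regCoeff f (α + μ)) x * pser (regCoeff f (β + μ)) x) : ℝ) : EReal) := by
  have hM : 0 < α + β + μ := by linarith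
  have pM := pser_regCoeff_pos hf hlc hM.le hx
  have p1 := pser_regCoeff_pos hf hlc h1 hx
  have p2 := pser_regCoeff_pos hf hlc h2 hx
  by_cases hμ' : μ = -1 ∨ μ = 0
  · have pμ : 0 < pser (regCoeff f μ) x := by
      rcases hμ' with rfl | rfl
      · exact pser_regCoeff_neg_one_pos hf hlc hx
      · exact pser_regCoeff_pos hf hlc le_rfl hx
    rw [extGamma_div_eq_zero hM hμ']
    exact EReal.coe_pos.2 (by positivity)
  · rw [not_or] at hμ'
    have hμ1 : -1 < μ := lt_of_le_of_ne hμ (Ne.symm hμ'.1)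
    by_cases h0 : α + μ = 0 ∨ β + μ = 0
    · have hneg : μ < 0 := by rcases h0 with h | h <;> linarith
      rw [extGamma_quot_eq_bot h1 h2 h0 hM hμ1 hneg]
      exact EReal.bot_lt_coe _
    · rw [not_or] at h0
      have h1' := lt_of_le_of_ne h1 (Ne.symm h0.1)
      have h2' := lt_of_le_of_ne h2 (Ne.symm h0.2)
      rw [extGamma_quot_eq_coe h1' h2' hM hμ'.2 hμ'.1, EReal.coe_lt_coe_iff]
      exact gammaQuot_lt_regQuot hf hlc hf0 hμ1 hμ'.2 hα hβ h1' h2' hx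

theorem extGamma_quot_eq_invGamma (h1 : 0 < α + μ) (h2 : 0 < β + μ) (hM : 0 < α + β + μ) :
    extGamma (α + μ) * extGamma (β + μ) / (extGamma μ * extGamma (α + β + μ)) =
      ((invGamma μ * invGamma (α + β + μ) / (invGamma (α + μ) * invGamma (β + μ)) : ℝ) :
        EReal) := by
  by_cases hμ' : μ = -1 ∨ μ = 0
  · rw [extGamma_div_eq_zero hM hμ']
    rcases hμ' with rfl | rfl
    · rw [invGamma_neg_one]; simp
    · rw [invGamma_zero]; simp
  · rw [not_or] at hμ'
    rw [extGamma_quot_eq_coe h1 h2 hM hμ'.2 hμ'.1]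
    congr 1
    simp only [invGamma, ← mul_inv]
    rw [inv_div_inv]

end Ratio

/-! ### The hypergeometric series -/

section Hypergeometric

variable {p q : ℕ} (a : Fin p → ℝ) (b : Fin q → ℝ)

theorem regHypTerm_eq (ν x : ℝ) (n : ℕ) :
    regHypTerm a b ν x n = regCoeff (risingQuot a b) ν n * x ^ n := by
  simp only [regHypTerm, regCoeff, risingQuot, invGamma]
  ring

theorem regHyp_eq : regHyp a b = fun ν => pser (regCoeff (risingQuot a b) ν) := by
  funext ν x
  simp only [regHyp, pser, regHypTerm_eq]

theorem hypTerm_cons_eq (ν x : ℝ) (n : ℕ) :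
    hypTerm a (Fin.cons ν b : Fin (q + 1) → ℝ) x n =
      normCoeff (risingQuot a b) ν n * x ^ n := by
  simp only [hypTerm, normCoeff, risingQuot, Fin.prod_univ_succ, Fin.cons_zero, Fin.cons_succ]
  ring

end Hypergeometric

end HypTuran

open HypTuran in
theorem mainTheorem9 (p q : ℕ) (hpq : p ≤ q) (a : Fin p → ℝ) (b : Fin q → ℝ)
    (ha : ∀ i, 0 < a i) (hb : ∀ j, 0 < b j) (hchain : HypTuran.SymmetricChain a b) :
    -- the power series of `f(ν, x)` converges everywhere, and `f(ν, x) = Γ(ν)⁻¹ _pF_{q+1}`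
    (∀ ν x : ℝ, Summable (HypTuran.regHypTerm a b ν x)) ∧
    (∀ ν x : ℝ, (∀ n : ℕ, ν ≠ -(n : ℝ)) →
      Summable (HypTuran.hypTerm a (Fin.cons ν b : Fin (q + 1) → ℝ) x) ∧
      HypTuran.regHyp a b ν x =
        (Real.Gamma ν)⁻¹ * HypTuran.hyp a (Fin.cons ν b : Fin (q + 1) → ℝ) x) ∧
    -- strict log-concavity in `ν`
    (∀ x : ℝ, 0 ≤ x →
      HypTuran.StrictLogConcaveOn (Set.Ioi 0) (fun ν => HypTuran.regHyp a b ν x)) ∧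
    ∀ μ α β : ℝ, -1 ≤ μ → 0 < α → 0 < β → 0 ≤ μ + α → 0 ≤ μ + β →
      -- power series coefficients
      (∃ c : ℕ → ℝ,
        (∀ x : ℝ, HasSum (fun m => c m * x ^ m)
          (HypTuran.turanian (HypTuran.regHyp a b) α β μ x)) ∧
        (∀ m, 0 ≤ c m) ∧
        (∀ m, c m = 0 ↔
          (m = 0 ∧ μ = -1 ∧ (α = 1 ∨ β = 1)) ∨ (m = 1 ∧ μ + α = 0 ∧ μ + β = 0))) ∧
      AbsolutelyMonotoneOn (HypTuran.turanian (HypTuran.regHyp a b) α β μ) (Set.Ioi 0) ∧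
      HypTuran.MultiplicativelyConvex (HypTuran.turanian (HypTuran.regHyp a b) α β μ) ∧
      -- complete monotonicity, log-convexity and integral representation
      HypTuran.CompletelyMonotone
        (fun y => HypTuran.turanian (HypTuran.regHyp a b) α β μ (1 / y)) ∧
      HypTuran.LogConvexOn (Set.Ioi 0)
        (fun y => HypTuran.turanian (HypTuran.regHyp a b) α β μ (1 / y)) ∧
      (∃ τ : MeasureTheory.Measure ℝ, τ (Set.Iio 0) = 0 ∧
        ∀ x : ℝ, 0 < x →
          MeasureTheory.IntegrableOn (fun t => Real.exp (-t / x)) (Set.Ici 0) τ ∧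
          HypTuran.turanian (HypTuran.regHyp a b) α β μ x =
            ∫ t in Set.Ici 0, Real.exp (-t / x) ∂τ) ∧
      -- two-sided bound: strict for `x > 0`; at `x = 0` the left inequality is an equality
      (∀ x : ℝ, 0 < x →
        0 < HypTuran.regHyp a b (α + μ) x ∧ 0 < HypTuran.regHyp a b (β + μ) x ∧
        HypTuran.extGamma (α + μ) * HypTuran.extGamma (β + μ) /
            (HypTuran.extGamma μ * HypTuran.extGamma (α + β + μ)) <
          ((HypTuran.regHyp a b μ x * HypTuran.regHyp a b (α + β + μ) x /
            (HypTuran.regHyp a b (α + μ) x * HypTuran.regHyp a b (β + μ) x) : ℝ) : EReal) ∧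
        HypTuran.regHyp a b μ x * HypTuran.regHyp a b (α + β + μ) x /
            (HypTuran.regHyp a b (α + μ) x * HypTuran.regHyp a b (β + μ) x) < 1) ∧
      (0 < μ + α → 0 < μ + β →
        0 < HypTuran.regHyp a b (α + μ) 0 ∧ 0 < HypTuran.regHyp a b (β + μ) 0 ∧
        HypTuran.extGamma (α + μ) * HypTuran.extGamma (β + μ) /
            (HypTuran.extGamma μ * HypTuran.extGamma (α + β + μ)) =
          ((HypTuran.regHyp a b μ 0 * HypTuran.regHyp a b (α + β + μ) 0 /
            (HypTuran.regHyp a b (α + μ) 0 * HypTuran.regHyp a b (β + μ) 0) : ℝ) : EReal) ∧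
        HypTuran.regHyp a b μ 0 * HypTuran.regHyp a b (α + β + μ) 0 /
            (HypTuran.regHyp a b (α + μ) 0 * HypTuran.regHyp a b (β + μ) 0) < 1) ∧
      -- lower bound, with equality only at `x = 0`
      (∀ x : ℝ, 0 ≤ x →
        1 / (Real.Gamma (μ + α) * Real.Gamma (μ + β)) -
            1 / (Real.Gamma μ * Real.Gamma (μ + α + β)) ≤
          HypTuran.turanian (HypTuran.regHyp a b) α β μ x ∧
        (HypTuran.turanian (HypTuran.regHyp a b) α β μ x =
            1 / (Real.Gamma (μ + α) * Real.Gamma (μ + β)) -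
              1 / (Real.Gamma μ * Real.Gamma (μ + α + β)) ↔ x = 0)) := by
  have hf := risingQuot_pos ha hb
  have hlc : ∀ k l, k ≤ l → risingQuot a b k * risingQuot a b (l + 1) ≤
      risingQuot a b (k + 1) * risingQuot a b l :=
    fun k l hkl => risingQuot_logConcave hpq ha hb hchain hkl
  have hf0 : risingQuot a b 0 = 1 := risingQuot_zero
  have he := entireCoeff_regCoeff hf hlc
  refine ⟨fun ν x => ?_, fun ν x hν => ⟨?_, ?_⟩, ?_, ?_⟩
  · simpa only [funext (regHypTerm_eq a b ν x)] using he ν x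
  · simpa only [funext (hypTerm_cons_eq a b ν x)] using entireCoeff_normCoeff hf hlc hν x
  · simp only [hyp, hypTerm_cons_eq, regHyp_eq]
    exact pser_regCoeff hν x
  · intro x hx
    rw [regHyp_eq]
    exact strictLogConcaveOn_pser_regCoeff hf hlc hx
  intro μ α β hμ hα hβ h1 h2
  obtain ⟨hent, hser⟩ := turanian_pser hf hlc α β μ
  have hnn := turanianCoeff_nonneg hf hlc hμ hα hβ h1 h2
  have hiff := turanianCoeff_eq_zero_iff hf hlc hμ hα hβ h1 h2
  -- The coefficient of `x ^ 2` is never one of the exceptions.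
  have hpos2 : 0 < turanianCoeff (risingQuot a b) α β μ 2 :=
    turanianCoeff_pos hf hlc hμ hα hβ h1 h2 (by simp) (by simp)
  have h1' : 0 ≤ α + μ := by linarith
  have h2' : 0 ≤ β + μ := by linarith
  have hM : 0 < α + β + μ := by linarith
  rw [regHyp_eq, hser]
  have hfac : ∀ x, pser (turanianCoeff (risingQuot a b) α β μ) x =
      pser (regCoeff (risingQuot a b) (α + μ)) x * pser (regCoeff (risingQuot a b) (β + μ)) x -
        pser (regCoeff (risingQuot a b) (α + β + μ)) x * pser (regCoeff (risingQuot a b) μ) x :=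
    fun x => (congrFun hser x).symm
  refine ⟨⟨_, fun x => (hent x).hasSum, hnn, hiff⟩, absolutelyMonotoneOn_pser hent hnn,
    multiplicativelyConvex_pser hent hnn hpos2, completelyMonotone_pser_one_div hent hnn,
    logConvexOn_pser_one_div hent hnn hpos2, exists_measure_pser hent hnn, ?_, ?_, ?_⟩
  · intro x hx
    have p1 := pser_regCoeff_pos hf hlc h1' hx
    have p2 := pser_regCoeff_pos hf hlc h2' hx
    refine ⟨p1, p2, extGamma_quot_lt_regQuot hf hlc hf0 hμ hα hβ h1' h2' hx, ?_⟩
    have := hfac x ▸ pser_pos hent hnn hpos2 hx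
    rw [div_lt_one (mul_pos p1 p2)]
    linarith
  · intro h3 h4
    have h3' : 0 < α + μ := by linarith
    have h4' : 0 < β + μ := by linarith
    have e0 : ∀ ν, pser (regCoeff (risingQuot a b) ν) 0 = invGamma ν := fun ν => by
      rw [pser_zero, regCoeff, hf0]
      simp
    simp only [e0]
    have p1 := invGamma_pos h3'
    have p2 := invGamma_pos h4'
    refine ⟨p1, p2, extGamma_quot_eq_invGamma h3' h4' hM, ?_⟩
    rw [div_lt_one (mul_pos p1 p2), mul_comm]
    refine invGamma_mul_lt hμ hα hβ h1 h2 ?_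
    rintro ⟨rfl, rfl | rfl⟩
    · norm_num at h3
    · norm_num at h4
  · have hc0 : 1 / (Real.Gamma (μ + α) * Real.Gamma (μ + β)) -
        1 / (Real.Gamma μ * Real.Gamma (μ + α + β)) =
        turanianCoeff (risingQuot a b) α β μ 0 := by
      rw [turanianCoeff_zero, hf0, add_comm α μ, add_comm β μ,
        show α + β + μ = μ + α + β by ring]
      simp only [invGamma, ← mul_inv]
      rw [mul_comm (Real.Gamma μ)]
      ring
    intro x hx
    rw [hc0]
    rcases hx.eq_or_lt with rfl | hx
    · rw [pser_zero]; simp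
    · have hlt := coeff_zero_lt_pser hent hnn two_ne_zero hpos2 hx
      exact ⟨hlt.le, fun h => absurd h hlt.ne', fun h => absurd h hx.ne'⟩
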